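/- Let $q>3$ and let $u\in C^4(\mathbf R^3)$ be a positive solution of $\Delta^2u=-u^{-q}$ on all of $\mathbf R^3$. Suppose that there are $L>0$ and $0<\vartheta<1$ such that $|x|^{-1}u(x)-L=o(|x|^{-\vartheta})$ as $|x|\to\infty$. For $y\in\mathbf R^3\setminus\{0\}$ let $v(y)=|x|^{-1}u(x)-L$, where $x=y/|y|^2$ (the Kelvin transform of $u$). For $s>0$ and $\theta\in\mathbb S^2$ put $$\overline v(s)=\frac1{|\mathbb S^2|}\int_{\mathbb S^2}v(s\theta)\,d\theta,\qquad w(s,\theta)=v(s\theta)-\overline v(s),\qquad W(s)=\Big(\int_{\mathbb S^2}w(s,\theta)^2\,d\theta\Big)^{1/2},$$ where $d\theta$ is the surface measure on the unit sphere $\mathbb S^2\subset\mathbf R^3$. Then there exist $C>0$ and $s_0>0$ such that $W(s)\le Cs$ for all $s\in(0,s_0)$. -/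

import Mathlib

open MeasureTheory Filter Asymptotics Metric
open scoped Topology Laplacian

noncomputable section

/-- Euclidean three-space. -/
abbrev R3 : Type := EuclideanSpace ℝ (Fin 3)

/-- The unit sphere `𝕊²` in three-space. -/
abbrev S2 : Type := sphere (0 : R3) 1

/-- The surface measure of `𝕊²` (of total mass `4π`). -/
def surfaceMeasure : Measure S2 := (volume : Measure R3).toSphere

/-- `u` is a positive entire `C⁴` solution of `Δ² u = -u^(-q)` in three-space. -/
structure IsPositiveEntireSolution (q : ℝ) (u : R3 → ℝ) : Prop where
  contDiff : ContDiff ℝ 4 u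
  pos : ∀ x, 0 < u x
  eqn : ∀ x, (Δ (Δ u)) x = -(u x) ^ (-q)

/-- The growth condition `|x|⁻¹ u(x) - L = o(|x|^(-ϑ))` as `|x| → ∞`. -/
def GrowthCondition (u : R3 → ℝ) (L ϑ : ℝ) : Prop :=
  (fun x : R3 => ‖x‖⁻¹ * u x - L) =o[Bornology.cobounded R3] fun x : R3 => ‖x‖ ^ (-ϑ)

/-- The inversion `y ↦ y / |y|²` (its own inverse off the origin). -/
def inversion (y : R3) : R3 := (‖y‖ ^ 2)⁻¹ • y

/-- The Kelvin transform: `v(y) = |x|⁻¹ u(x) - L` where `y = x / |x|²`, that is `x = y / |y|²`. -/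
def kelvin (u : R3 → ℝ) (L : ℝ) (y : R3) : ℝ := ‖inversion y‖⁻¹ * u (inversion y) - L

/-- The spherical average of `v` over the sphere of radius `s`:
`(1 / |𝕊²|) ∫_{𝕊²} v(s θ) dθ`. -/
def sphericalAverage (v : R3 → ℝ) (s : ℝ) : ℝ :=
  (surfaceMeasure.real Set.univ)⁻¹ * ∫ θ : S2, v (s • (θ : R3)) ∂surfaceMeasure

/-- The non-radial part `w(s, θ) = v(s, θ) - v̄(s)` in polar coordinates. -/
def nonRadialPart (v : R3 → ℝ) (s : ℝ) (θ : S2) : ℝ :=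
  v (s • (θ : R3)) - sphericalAverage v s

/-- `W(s) = (∫_{𝕊²} w(s, θ)² dθ)^(1/2)`, the `L²(𝕊²)`-norm of the non-radial part of `v`. -/
def nonRadialNorm (v : R3 → ℝ) (s : ℝ) : ℝ :=
  Real.sqrt (∫ θ : S2, nonRadialPart v s θ ^ 2 ∂surfaceMeasure)

end

open scoped ContDiff

/-! Since `v(sθ) = s u(θ/s) - L`, it suffices that the oscillation of `u` on the sphere of radius
`r` is bounded uniformly in `r`; the factor `s` then gives `W(s) ≤ Cs`.

Given `|x| = |x'|`, let `T` be the reflection swapping `x` and `x'`. The linear part of `u` cancels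
in `w = u - u ∘ T`, so `w = o(|y|)`, and `Δ²w = -(f - f ∘ T)` with `f = u^(-q)`. As `u` is bounded
below by a multiple of `1 + |y|` and `q > 3`, `f` is integrable. In three-space `|y|` is a multiple
of the fundamental solution of `Δ²`, and sublinear growth excludes nonconstant biharmonic
corrections, so `w` is a potential of `f - f ∘ T` (`integral_mul_bilaplacian_of_isLittleO`). By
antisymmetry, radial terms may be added to the kernel at no cost; it becomes `|y - x| - max(|x|,
|y|)`, of size at most `min(|x|, |y|)` (`sub_comp_eq_integral`).

A bootstrap concludes. Oscillation `O((1 + r)^α)` gives `f - f ∘ T = O((1 + |y|)^(α - q - 1))`, and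
inserting this in the potential yields exponent `β` whenever `α - β < q - 3`
(`oscillationBound_improve`). Finitely many steps lead from `α = 1` to `0`. -/

/-! ### The Laplacian: Green's identity, radial functions, isometries -/

theorem laplacian_eq_sum_fderiv {ι E : Type*} [Fintype ι] [NormedAddCommGroup E]
    [InnerProductSpace ℝ E] [FiniteDimensional ℝ E] (e : OrthonormalBasis ι ℝ E) {u : E → ℝ}
    (hu : ContDiff ℝ 2 u) (x : E) :
    (Δ u) x = ∑ i, fderiv ℝ (fun y => fderiv ℝ u y (e i)) x (e i) := by
  rw [InnerProductSpace.laplacian_eq_iteratedFDeriv_orthonormalBasis u e]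
  refine Finset.sum_congr rfl fun i _ => ?_
  have h : DifferentiableAt ℝ (fderiv ℝ u) x :=
    (hu.fderiv_right (m := 1) (by norm_num)).differentiable (by norm_num) x
  rw [iteratedFDeriv_two_apply, fderiv_clm_apply h (differentiableAt_const _)]
  simp

theorem ContDiff.fderiv_apply_const {E : Type*} [NormedAddCommGroup E] [NormedSpace ℝ E]
    {u : E → ℝ} {m n : ℕ∞} (hu : ContDiff ℝ n u) (hmn : m + 1 ≤ n) (v : E) :
    ContDiff ℝ m fun y => fderiv ℝ u y v :=
  (hu.fderiv_right (m := m) (by exact_mod_cast hmn)).clm_apply contDiff_const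

theorem contDiff_laplacian {E : Type*} [NormedAddCommGroup E]
    [InnerProductSpace ℝ E] [FiniteDimensional ℝ E] {u : E → ℝ} {m : ℕ∞}
    (hu : ContDiff ℝ (m + 2 : ℕ∞) u) : ContDiff ℝ m (Δ u) := by
  have h2 : ContDiff ℝ 2 u := hu.of_le (WithTop.coe_le_coe.2 (le_add_self : (2 : ℕ∞) ≤ m + 2))
  rw [show Δ u = fun x => _ from
    funext fun x => laplacian_eq_sum_fderiv (stdOrthonormalBasis ℝ E) h2 x]
  refine ContDiff.sum fun i _ => ?_
  refine ContDiff.fderiv_apply_const (n := m + 1) ?_ le_rfl _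
  refine ContDiff.fderiv_apply_const (n := m + 2) hu ?_ _
  rw [add_assoc, one_add_one_eq_two]

theorem integral_mul_laplacian_comm {E : Type*} [NormedAddCommGroup E]
    [InnerProductSpace ℝ E] [FiniteDimensional ℝ E] [MeasurableSpace E] [BorelSpace E]
    {u φ : E → ℝ} (hu : ContDiff ℝ 2 u) (hφ : ContDiff ℝ 2 φ) (hc : HasCompactSupport φ) :
    ∫ y, u y * (Δ φ) y = ∫ y, φ y * (Δ u) y := by
  set e := stdOrthonormalBasis ℝ E
  have d1 {f : E → ℝ} (hf : ContDiff ℝ 2 f) (i) : ContDiff ℝ 1 fun y => fderiv ℝ f y (e i) :=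
    ContDiff.fderiv_apply_const (m := 1) (n := 2) hf (by norm_num) _
  have d2 {f : E → ℝ} (hf : ContDiff ℝ 2 f) (i) :
      Continuous fun x => fderiv ℝ (fun y => fderiv ℝ f y (e i)) x (e i) :=
    ((d1 hf i).continuous_fderiv (by norm_num)).clm_apply continuous_const
  have c1 (i) : HasCompactSupport fun y => fderiv ℝ φ y (e i) := hc.fderiv_apply (𝕜 := ℝ) (e i)
  have c2 (i) : HasCompactSupport fun x => fderiv ℝ (fun y => fderiv ℝ φ y (e i)) x (e i) :=
    (c1 i).fderiv_apply (𝕜 := ℝ) (e i)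
  have i1 (i) : Integrable fun x => u x * fderiv ℝ (fun y => fderiv ℝ φ y (e i)) x (e i) :=
    (hu.continuous.mul (d2 hφ i)).integrable_of_hasCompactSupport (c2 i).mul_left
  have i2 (i) : Integrable fun x => φ x * fderiv ℝ (fun y => fderiv ℝ u y (e i)) x (e i) :=
    (hφ.continuous.mul (d2 hu i)).integrable_of_hasCompactSupport hc.mul_right
  have i3 (i) : Integrable fun x => fderiv ℝ u x (e i) * fderiv ℝ φ x (e i) :=
    ((d1 hu i).continuous.mul (d1 hφ i).continuous).integrable_of_hasCompactSupport (c1 i).mul_left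
  simp_rw [laplacian_eq_sum_fderiv e hu, laplacian_eq_sum_fderiv e hφ, Finset.mul_sum]
  rw [integral_finsetSum _ fun i _ => i1 i, integral_finsetSum _ fun i _ => i2 i]
  refine Finset.sum_congr rfl fun i _ => ?_
  have i3' : Integrable fun x => fderiv ℝ φ x (e i) * fderiv ℝ u x (e i) :=
    (i3 i).congr (.of_forall fun x => mul_comm _ _)
  rw [integral_mul_fderiv_eq_neg_fderiv_mul_of_integrable (v := e i) (i3 i) (i1 i)
    ((hu.continuous.mul (d1 hφ i).continuous).integrable_of_hasCompactSupport (c1 i).mul_left)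
    (fun x _ => hu.differentiable (by norm_num) x) (fun x _ => (d1 hφ i).differentiable (by norm_num) x),
    integral_mul_fderiv_eq_neg_fderiv_mul_of_integrable (v := e i) i3' (i2 i)
    ((hφ.continuous.mul (d1 hu i).continuous).integrable_of_hasCompactSupport hc.mul_right)
    (fun x _ => hφ.differentiable (by norm_num) x) (fun x _ => (d1 hu i).differentiable (by norm_num) x)]
  congr 1
  exact integral_congr_ae (.of_forall fun x => mul_comm _ _)

theorem laplacian_radial {E : Type*} [NormedAddCommGroup E]
    [InnerProductSpace ℝ E] [FiniteDimensional ℝ E] {g g₁ g₂ : ℝ → ℝ}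
    (hd : ContDiff ℝ 2 fun y : E => g (‖y‖ ^ 2))
    (h₁ : ∀ s, 0 ≤ s → HasDerivAt g (g₁ s) s) (h₂ : ∀ s, 0 ≤ s → HasDerivAt g₁ (g₂ s) s) (x : E) :
    (Δ fun y : E => g (‖y‖ ^ 2)) x =
      4 * ‖x‖ ^ 2 * g₂ (‖x‖ ^ 2) + 2 * Module.finrank ℝ E * g₁ (‖x‖ ^ 2) := by
  have hn (y : E) : HasFDerivAt (fun y : E => ‖y‖ ^ 2) (2 • innerSL ℝ y) y :=
    (hasStrictFDerivAt_norm_sq y).hasFDerivAt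
  have k1 (y v : E) : fderiv ℝ (fun y : E => g (‖y‖ ^ 2)) y v
      = g₁ (‖y‖ ^ 2) * (2 * inner ℝ y v) := by
    have h := ((h₁ _ (sq_nonneg ‖y‖)).comp_hasFDerivAt y (hn y)).fderiv
    rw [Function.comp_def] at h
    rw [h]
    simp [nsmul_eq_mul]
  have k2 (v : E) : fderiv ℝ (fun y : E => g₁ (‖y‖ ^ 2) * (2 * inner ℝ y v)) x v
      = 4 * g₂ (‖x‖ ^ 2) * inner ℝ x v ^ 2 + 2 * g₁ (‖x‖ ^ 2) * ‖v‖ ^ 2 := by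
    have hi : HasFDerivAt (fun y : E => 2 * inner ℝ y v) ((2 : ℝ) • innerSL ℝ v) x := by
      have := ((innerSL ℝ v).hasFDerivAt (x := x)).const_smul (2 : ℝ)
      refine this.congr_of_eventuallyEq (.of_forall fun y => ?_)
      simp [real_inner_comm]
    have h := (((h₂ _ (sq_nonneg ‖x‖)).comp_hasFDerivAt x (hn x)).fun_mul hi).fderiv
    simp only [Function.comp_def] at h
    rw [h]
    simp [nsmul_eq_mul]
    ring
  rw [laplacian_eq_sum_fderiv (stdOrthonormalBasis ℝ E) hd]
  simp_rw [k1, k2, Finset.sum_add_distrib, ← Finset.mul_sum]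
  rw [show ∑ i, inner ℝ x (stdOrthonormalBasis ℝ E i) ^ 2 = ‖x‖ ^ 2 from
    (stdOrthonormalBasis ℝ E).sum_sq_inner_left x]
  simp
  ring

theorem laplacian_comp_linearIsometryEquiv {E : Type*} [NormedAddCommGroup E]
    [InnerProductSpace ℝ E] [FiniteDimensional ℝ E] (u : E → ℝ) (T : E ≃ₗᵢ[ℝ] E) :
    Δ (fun y => u (T y)) = fun y => (Δ u) (T y) := by
  ext x
  set e := stdOrthonormalBasis ℝ E
  rw [InnerProductSpace.laplacian_eq_iteratedFDeriv_orthonormalBasis u (e.map T),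
    InnerProductSpace.laplacian_eq_iteratedFDeriv_orthonormalBasis _ e]
  refine Finset.sum_congr rfl fun i _ => ?_
  have h := T.toContinuousLinearEquiv.iteratedFDerivWithin_comp_right (f := u) (x := x)
    uniqueDiffOn_univ (Set.mem_univ _) 2
  simp only [Set.preimage_univ, iteratedFDerivWithin_univ] at h
  change iteratedFDeriv ℝ 2 (u ∘ T.toContinuousLinearEquiv) x _ = _
  rw [h]
  simp only [ContinuousMultilinearMap.compContinuousLinearMap_apply]
  congr 1
  ext j
  fin_cases j <;> simp

theorem laplacian_comp_add_const {E : Type*} [NormedAddCommGroup E]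
    [InnerProductSpace ℝ E] [FiniteDimensional ℝ E] (u : E → ℝ) (a : E) :
    Δ (fun y => u (y + a)) = fun y => (Δ u) (y + a) := by
  ext x
  simp only [InnerProductSpace.laplacian_eq_iteratedFDeriv_stdOrthonormalBasis,
    iteratedFDeriv_comp_add_right]

/-! ### Cutoffs of radial profiles -/

/-- The `k`-th derivative of `d 0 * χ (· / T)` for a tower of derivatives `d`. -/
noncomputable def cutoffDeriv (d : ℕ → ℝ → ℝ) (χ : ℝ → ℝ) (T : ℝ) (k : ℕ) (s : ℝ) : ℝ :=
  ∑ j ∈ Finset.range (k + 1),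
    (k.choose j : ℝ) * (d j s * ((T ^ (k - j))⁻¹ * iteratedDeriv (k - j) χ (s / T)))

theorem hasDerivAt_scaled_iteratedDeriv {χ : ℝ → ℝ} (hχ : ContDiff ℝ ∞ χ) {T : ℝ} (k : ℕ)
    (s : ℝ) :
    HasDerivAt (fun s => (T ^ k)⁻¹ * iteratedDeriv k χ (s / T))
      ((T ^ (k + 1))⁻¹ * iteratedDeriv (k + 1) χ (s / T)) s := by
  have h1 : HasDerivAt (iteratedDeriv k χ) (iteratedDeriv (k + 1) χ (s / T)) (s / T) := by
    rw [iteratedDeriv_succ]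
    exact ((hχ.differentiable_iteratedDeriv k (by exact_mod_cast ENat.natCast_lt_top k)) _).hasDerivAt
  have h2 := (h1.comp s ((hasDerivAt_id s).div_const T)).const_mul (T ^ k)⁻¹
  refine h2.congr_deriv ?_
  rw [pow_succ, mul_inv]
  ring

/-- Leibniz and Pascal's rule, checked order by order: a bilaplacian needs only derivatives up to
the fourth. -/
theorem hasDerivAt_cutoffDeriv {d : ℕ → ℝ → ℝ} {χ : ℝ → ℝ} (hχ : ContDiff ℝ ∞ χ) {T s : ℝ}
    (hd : ∀ k, HasDerivAt (d k) (d (k + 1) s) s) {k : ℕ} (hk : k < 4) :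
    HasDerivAt (cutoffDeriv d χ T k) (cutoffDeriv d χ T (k + 1) s) s := by
  have h : HasDerivAt (cutoffDeriv d χ T k) _ s :=
    HasDerivAt.fun_sum fun j (_ : j ∈ Finset.range (k + 1)) =>
      ((hd j).mul (hasDerivAt_scaled_iteratedDeriv hχ (T := T) (k - j) s)).const_mul
        (k.choose j : ℝ)
  refine h.congr_deriv ?_
  unfold cutoffDeriv
  interval_cases k <;> simp [Finset.sum_range_succ, Nat.choose] <;> ring

theorem cutoffDeriv_eq_of_lt {d : ℕ → ℝ → ℝ} {χ : ℝ → ℝ} (h1 : ∀ s, |s| ≤ 1 → χ s = 1)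
    {T s : ℝ} (hs : 0 ≤ s) (hT : s < T) (k : ℕ) : cutoffDeriv d χ T k s = d k s := by
  have hlt : |s / T| < 1 := by
    rw [abs_of_nonneg (div_nonneg hs (hs.trans hT.le)), div_lt_one (by linarith)]
    exact hT
  have h0 : χ =ᶠ[𝓝 (s / T)] fun _ => 1 := by
    filter_upwards [continuous_abs.continuousAt.eventually_lt continuousAt_const hlt] with t ht
    exact h1 t ht.le
  unfold cutoffDeriv
  rw [Finset.sum_eq_single k]
  · simp [h0.eq_of_nhds]
  · intro j hj hjk
    have : k - j ≠ 0 := by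
      have := Finset.mem_range.1 hj
      omega
    rw [h0.iteratedDeriv_eq]
    simp [iteratedDeriv_const, this]
  · simp

theorem iteratedDeriv_eq_zero_of_lt {χ : ℝ → ℝ} {R : ℝ} (h2 : ∀ s, R ≤ |s| → χ s = 0)
    {s : ℝ} (hs : R < |s|) (k : ℕ) : iteratedDeriv k χ s = 0 := by
  have h0 : χ =ᶠ[𝓝 s] fun _ => 0 := by
    filter_upwards [continuousAt_const.eventually_lt continuous_abs.continuousAt hs] with t ht
    exact h2 t ht.le
  rw [h0.iteratedDeriv_eq]
  simp

theorem cutoffDeriv_eq_zero {d : ℕ → ℝ → ℝ} {χ : ℝ → ℝ} (h2 : ∀ s, 2 ≤ |s| → χ s = 0)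
    {T s : ℝ} (hT : 0 < T) (hs : 2 * T < s) (k : ℕ) : cutoffDeriv d χ T k s = 0 := by
  have hlt : 2 < |s / T| := by
    rw [abs_of_pos (div_pos (by linarith) hT), lt_div_iff₀ hT]
    exact hs
  simp [cutoffDeriv, iteratedDeriv_eq_zero_of_lt h2 hlt]

theorem exists_bound_iteratedDeriv {χ : ℝ → ℝ} (hχ : ContDiff ℝ ∞ χ)
    (h2 : ∀ s, 2 ≤ |s| → χ s = 0) (n : ℕ) :
    ∃ M, 0 ≤ M ∧ ∀ k ≤ n, ∀ s, |iteratedDeriv k χ s| ≤ M := by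
  have h (k : ℕ) : ∃ M, ∀ s, |iteratedDeriv k χ s| ≤ M := by
    have hc : HasCompactSupport (iteratedDeriv k χ) := by
      refine HasCompactSupport.intro (isCompact_closedBall (0 : ℝ) 2) fun s hs => ?_
      rw [mem_closedBall, dist_zero_right, Real.norm_eq_abs, not_le] at hs
      exact iteratedDeriv_eq_zero_of_lt h2 hs k
    exact (hχ.continuous_iteratedDeriv k (by exact_mod_cast le_top)).bounded_above_of_compact_support hc
  choose M hM using h
  refine ⟨∑ k ∈ Finset.range (n + 1), |M k|, by positivity, fun k hk s => ?_⟩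
  refine (hM k s).trans ((le_abs_self _).trans ?_)
  exact Finset.single_le_sum (f := fun k => |M k|) (fun _ _ => abs_nonneg _)
    (Finset.mem_range.2 (by omega))

/-- Where the cutoff lives, `s ≤ 2T`, so `1 + s ≤ 3T`: a factor `T⁻¹` from differentiating `χ(s/T)`
is worth `3(1 + s)⁻¹`. Cutting off thus preserves the weighted decay uniformly in `T`; `2 ^ k` is
the sum of the binomial coefficients. -/
theorem cutoffDeriv_bound {d : ℕ → ℝ → ℝ} {χ : ℝ → ℝ} (h2 : ∀ s, 2 ≤ |s| → χ s = 0)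
    {M r T s : ℝ} {n : ℕ} (hM₀ : 0 ≤ M) (hM : ∀ k ≤ n, ∀ s, |iteratedDeriv k χ s| ≤ M)
    (hT : 1 ≤ T) (hs : 0 ≤ s) (hd : ∀ k ≤ n, |d k s| * (1 + s) ^ k ≤ r) {k : ℕ}
    (hk : k ≤ n) :
    |cutoffDeriv d χ T k s| * (1 + s) ^ k ≤ 2 ^ k * (r * (3 ^ n * M)) := by
  have hr : 0 ≤ r := le_trans (by positivity) (hd 0 (by omega))
  by_cases hsT : 2 * T < s
  · rw [cutoffDeriv_eq_zero h2 (by linarith) hsT]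
    simp only [abs_zero, zero_mul]
    positivity
  have hχb (j : ℕ) (hj : j ≤ n) :
      |(T ^ j)⁻¹ * iteratedDeriv j χ (s / T)| * (1 + s) ^ j ≤ 3 ^ n * M := by
    rw [abs_mul, abs_of_pos (by positivity)]
    have h3 : (1 + s) ^ j ≤ (3 * T) ^ j := pow_le_pow_left₀ (by positivity) (by linarith) _
    calc _ ≤ (T ^ j)⁻¹ * M * (3 * T) ^ j := by
          gcongr
          exact hM j hj _
      _ = 3 ^ j * M := by
          rw [mul_pow]
          field_simp
      _ ≤ 3 ^ n * M := by
          gcongr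
          norm_num
  calc _ ≤ (∑ j ∈ Finset.range (k + 1), (k.choose j : ℝ) *
        (|d j s| * |(T ^ (k - j))⁻¹ * iteratedDeriv (k - j) χ (s / T)|)) * (1 + s) ^ k := by
        gcongr
        refine (Finset.abs_sum_le_sum_abs _ _).trans_eq (Finset.sum_congr rfl fun j _ => ?_)
        rw [abs_mul, abs_mul, Nat.abs_cast]
    _ = ∑ j ∈ Finset.range (k + 1), (k.choose j : ℝ) * ((|d j s| * (1 + s) ^ j) *
        (|(T ^ (k - j))⁻¹ * iteratedDeriv (k - j) χ (s / T)| * (1 + s) ^ (k - j))) := by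
        rw [Finset.sum_mul]
        refine Finset.sum_congr rfl fun j hj => ?_
        have hjk : j + (k - j) = k := by
          have := Finset.mem_range.1 hj
          omega
        rw [show (1 + s) ^ k = (1 + s) ^ j * (1 + s) ^ (k - j) by rw [← pow_add, hjk]]
        ring
    _ ≤ ∑ j ∈ Finset.range (k + 1), (k.choose j : ℝ) * (r * (3 ^ n * M)) := by
        refine Finset.sum_le_sum fun j hj => ?_
        have := Finset.mem_range.1 hj
        exact mul_le_mul_of_nonneg_left (mul_le_mul (hd j (by omega)) (hχb (k - j) (by omega))
          (by positivity) hr) (by positivity)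
    _ = 2 ^ k * (r * (3 ^ n * M)) := by
        rw [← Finset.sum_mul]
        congr 1
        exact_mod_cast Nat.sum_range_choose k

/-! ### Testing the bilaplacian against radial functions -/

/-- The radial profile of the bilaplacian in three-space of a function with
radial profile derivatives `g`, as functions of `s = |y|²`. -/
def bilaplacianProfile (g : ℕ → ℝ → ℝ) (s : ℝ) : ℝ :=
  16 * s ^ 2 * g 4 s + 80 * s * g 3 s + 60 * g 2 s

theorem laplacian_profile {g : ℕ → ℝ → ℝ} (hφ : ContDiff ℝ 2 fun y : R3 => g 0 (‖y‖ ^ 2))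
    (hg : ∀ k < 4, ∀ s, 0 ≤ s → HasDerivAt (g k) (g (k + 1) s) s) :
    (Δ fun y : R3 => g 0 (‖y‖ ^ 2)) =
      fun y => 4 * ‖y‖ ^ 2 * g 2 (‖y‖ ^ 2) + 6 * g 1 (‖y‖ ^ 2) := by
  ext y
  rw [laplacian_radial hφ (hg 0 (by norm_num)) (hg 1 (by norm_num))]
  simp
  norm_num

theorem bilaplacian_profile {g : ℕ → ℝ → ℝ} (hφ : ContDiff ℝ 4 fun y : R3 => g 0 (‖y‖ ^ 2))
    (hg : ∀ k < 4, ∀ s, 0 ≤ s → HasDerivAt (g k) (g (k + 1) s) s) :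
    Δ (Δ fun y : R3 => g 0 (‖y‖ ^ 2)) = fun y => bilaplacianProfile g (‖y‖ ^ 2) := by
  have h1 := laplacian_profile (hφ.of_le (by norm_num)) hg
  have hc : ContDiff ℝ 2 (Δ fun y : R3 => g 0 (‖y‖ ^ 2)) := contDiff_laplacian (m := 2) hφ
  rw [h1] at hc ⊢
  ext y
  have := laplacian_radial (E := R3) (g := fun s => 4 * s * g 2 s + 6 * g 1 s)
    (g₁ := fun s => 4 * s * g 3 s + 10 * g 2 s) (g₂ := fun s => 4 * s * g 4 s + 14 * g 3 s) hc
    (fun s hs => ?_) (fun s hs => ?_) y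
  · rw [this]
    simp [bilaplacianProfile]
    ring
  · refine (((((hasDerivAt_id s).const_mul 4).mul (hg 2 (by norm_num) s hs))).add
      ((hg 1 (by norm_num) s hs).const_mul 6)).congr_deriv ?_
    simp
    ring
  · refine (((((hasDerivAt_id s).const_mul 4).mul (hg 3 (by norm_num) s hs))).add
      ((hg 2 (by norm_num) s hs).const_mul 10)).congr_deriv ?_
    simp
    ring

theorem integral_mul_bilaplacianProfile_of_compact {g : ℕ → ℝ → ℝ} {w : R3 → ℝ} {R : ℝ}
    (hw : ContDiff ℝ 4 w) (hφ : ContDiff ℝ 4 fun y : R3 => g 0 (‖y‖ ^ 2))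
    (hg : ∀ k < 4, ∀ s, 0 ≤ s → HasDerivAt (g k) (g (k + 1) s) s)
    (hR : ∀ k, ∀ s, R < s → g k s = 0) :
    ∫ y : R3, w y * bilaplacianProfile g (‖y‖ ^ 2) = ∫ y : R3, g 0 (‖y‖ ^ 2) * (Δ (Δ w)) y := by
  have hsupp {G : R3 → ℝ} (hG : ∀ y, R < ‖y‖ ^ 2 → G y = 0) : HasCompactSupport G := by
    refine HasCompactSupport.intro (isCompact_closedBall (0 : R3) (√R)) fun y hy => hG y ?_
    rw [mem_closedBall, dist_zero_right, not_le] at hy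
    exact (Real.sqrt_lt' (lt_of_le_of_lt (Real.sqrt_nonneg R) hy)).1 hy
  have hw2 : ContDiff ℝ 2 w := hw.of_le (by norm_num)
  have hφ2 : ContDiff ℝ 2 fun y : R3 => g 0 (‖y‖ ^ 2) := hφ.of_le (by norm_num)
  rw [← integral_mul_laplacian_comm (contDiff_laplacian (m := 2) hw) hφ2
    (hsupp fun y hy => hR 0 _ hy)]
  have hb := bilaplacian_profile hφ hg
  simp_rw [← funext_iff.1 hb]
  rw [integral_mul_laplacian_comm hw2 (contDiff_laplacian (m := 2) hφ)]
  · exact integral_congr_ae (.of_forall fun y => mul_comm _ _)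
  · refine hsupp fun y hy => ?_
    rw [laplacian_profile hφ2 hg]
    simp [hR _ _ hy]

theorem integrable_inv_one_add_norm_sq_sq : Integrable fun y : R3 => ((1 + ‖y‖ ^ 2) ^ 2)⁻¹ := by
  have := integrable_rpow_neg_one_add_norm_sq (E := R3) (μ := volume) (r := 4) (by simp; norm_num)
  refine this.congr (.of_forall fun y => ?_)
  have h : (0 : ℝ) < 1 + ‖y‖ ^ 2 := by positivity
  simp only
  rw [show -(4 : ℝ) / 2 = -(2 : ℕ) by norm_num, Real.rpow_neg h.le, Real.rpow_natCast]

theorem one_add_le_two_mul_sqrt (t : ℝ) : 1 + t ≤ 2 * √(1 + t ^ 2) := by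
  have h : √(1 + t ^ 2) ^ 2 = 1 + t ^ 2 := Real.sq_sqrt (by positivity)
  have h0 := Real.sqrt_nonneg (1 + t ^ 2)
  nlinarith [sq_nonneg (t - 1), sq_nonneg (1 + t)]

/-- Each power of `s` offsets one derivative, so every term decays like a second derivative; `1136 =
16·2⁴ + 80·2³ + 60·2²`. -/
theorem abs_bilaplacianProfile_mul_le {g : ℕ → ℝ → ℝ} {s A : ℝ} (hs : 0 ≤ s)
    (hg : ∀ k ≤ 4, |g k s| * (1 + s) ^ k ≤ 2 ^ k * A) :
    |bilaplacianProfile g s| * (1 + s) ^ 2 ≤ 1136 * A := by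
  have h4 := hg 4 le_rfl
  have h3 := hg 3 (by norm_num)
  have h2 := hg 2 (by norm_num)
  have e4 : s ^ 2 * |g 4 s| * (1 + s) ^ 2 ≤ |g 4 s| * (1 + s) ^ 4 := by
    have : s ^ 2 ≤ (1 + s) ^ 2 := by gcongr; linarith
    calc _ ≤ (1 + s) ^ 2 * |g 4 s| * (1 + s) ^ 2 := by gcongr
      _ = _ := by ring
  have e3 : s * |g 3 s| * (1 + s) ^ 2 ≤ |g 3 s| * (1 + s) ^ 3 := by
    calc _ ≤ (1 + s) * |g 3 s| * (1 + s) ^ 2 := by gcongr; linarith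
      _ = _ := by ring
  calc _ ≤ (16 * s ^ 2 * |g 4 s| + 80 * s * |g 3 s| + 60 * |g 2 s|) * (1 + s) ^ 2 := by
        gcongr
        unfold bilaplacianProfile
        refine (abs_add_three _ _ _).trans_eq ?_
        simp [abs_mul, abs_of_nonneg hs]
    _ ≤ 1136 * A := by linarith

/-- Testing the bilaplacian against a decaying radial function. -/
theorem integral_mul_bilaplacianProfile {d : ℕ → ℝ → ℝ} {w : R3 → ℝ} {K C : ℝ}
    (hw : ContDiff ℝ 4 w) (hφ : ContDiff ℝ 4 fun y : R3 => d 0 (‖y‖ ^ 2))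
    (hd : ∀ k s, 0 ≤ s → HasDerivAt (d k) (d (k + 1) s) s)
    (hK : ∀ k ≤ 4, ∀ s, 0 ≤ s → |d k s| * (1 + s) ^ k ≤ K * (√(1 + s))⁻¹)
    (hC : ∀ y, |w y| ≤ C * (1 + ‖y‖)) (hi : Integrable (Δ (Δ w))) :
    ∫ y : R3, w y * bilaplacianProfile d (‖y‖ ^ 2) = ∫ y : R3, d 0 (‖y‖ ^ 2) * (Δ (Δ w)) y := by
  let b : ContDiffBump (0 : ℝ) := ⟨1, 2, one_pos, one_lt_two⟩
  set χ : ℝ → ℝ := fun s => b s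
  have hχ : ContDiff ℝ ∞ χ := b.contDiff
  have h1 : ∀ s, |s| ≤ 1 → χ s = 1 := fun s hs =>
    b.one_of_mem_closedBall (by simpa [b] using hs)
  have h2 : ∀ s, 2 ≤ |s| → χ s = 0 := fun s hs =>
    b.zero_of_le_dist (by simpa [b] using hs)
  obtain ⟨M, hM₀, hM⟩ := exists_bound_iteratedDeriv hχ h2 4
  set g : ℝ → ℕ → ℝ → ℝ := cutoffDeriv d χ
  have hg (T : ℝ) : ∀ k < 4, ∀ s, 0 ≤ s → HasDerivAt (g T k) (g T (k + 1) s) s :=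
    fun k hk s hs => hasDerivAt_cutoffDeriv hχ (fun k => hd k s hs) hk
  have hgφ (T : ℝ) : ContDiff ℝ 4 fun y : R3 => g T 0 (‖y‖ ^ 2) := by
    have : ContDiff ℝ 4 fun y : R3 => χ (‖y‖ ^ 2 / T) :=
      (contDiff_infty.1 hχ 4).comp ((contDiff_norm_sq ℝ).div_const T)
    simpa [g, cutoffDeriv] using hφ.mul this
  have hgc (T : ℝ) (k : ℕ) (hk : k ≤ 4) : Continuous fun y : R3 => g T k (‖y‖ ^ 2) := by
    refine continuous_finsetSum _ fun j _ => continuous_const.mul (Continuous.mul ?_ ?_)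
    · exact continuous_iff_continuousAt.2 fun y => ContinuousAt.comp (f := fun y : R3 => ‖y‖ ^ 2)
        (hd j _ (sq_nonneg ‖y‖)).continuousAt (by fun_prop)
    · exact continuous_const.mul ((hχ.continuous_iteratedDeriv _ (WithTop.coe_le_coe.2 le_top)).comp
        (by fun_prop))
  have hgb (T : ℝ) (hT : 1 ≤ T) (s : ℝ) (hs : 0 ≤ s) (k : ℕ) (hk : k ≤ 4) :
      |g T k s| * (1 + s) ^ k ≤ 2 ^ k * (K * (√(1 + s))⁻¹ * (3 ^ 4 * M)) :=
    cutoffDeriv_bound h2 hM₀ hM hT hs (fun k hk => hK k hk s hs) hk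
  have hid (T : ℝ) (hT : 1 ≤ T) : ∫ y : R3, w y * bilaplacianProfile (g T) (‖y‖ ^ 2) =
      ∫ y : R3, g T 0 (‖y‖ ^ 2) * (Δ (Δ w)) y :=
    integral_mul_bilaplacianProfile_of_compact (R := 2 * T) hw (hgφ T) (hg T)
      fun k s hs => cutoffDeriv_eq_zero h2 (by linarith) hs k
  have hK0 : 0 ≤ K := by
    have := hK 0 (by norm_num) 0 le_rfl
    simp only [pow_zero, mul_one, add_zero, Real.sqrt_one, inv_one] at this
    exact (abs_nonneg _).trans this
  have hC0 : 0 ≤ C := by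
    have := hC 0
    simp only [norm_zero, add_zero, mul_one] at this
    exact (abs_nonneg _).trans this
  have hev (y : R3) (k : ℕ) : ∀ᶠ T in atTop, g T k (‖y‖ ^ 2) = d k (‖y‖ ^ 2) := by
    filter_upwards [eventually_gt_atTop (‖y‖ ^ 2)] with T hT
    exact cutoffDeriv_eq_of_lt h1 (sq_nonneg _) hT k
  have hl : Tendsto (fun T => ∫ y : R3, w y * bilaplacianProfile (g T) (‖y‖ ^ 2)) atTop
      (𝓝 (∫ y : R3, w y * bilaplacianProfile d (‖y‖ ^ 2))) := by
    refine tendsto_integral_filter_of_dominated_convergence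
      -- With `s = |y|²`, the profile is `O((1 + s)^(-5/2))` and `w` is `O((1 + s)^(1/2))`; the
      -- product `(1 + |y|²)⁻²` is integrable in dimension three.
      (fun y => C * 2 * (1136 * (K * (3 ^ 4 * M))) * ((1 + ‖y‖ ^ 2) ^ 2)⁻¹) ?_ ?_ ?_ ?_
    · refine .of_forall fun T => (hw.continuous.mul ?_).aestronglyMeasurable
      have hn : Continuous fun y : R3 => ‖y‖ ^ 2 := by fun_prop
      exact ((((continuous_const.mul (hn.pow 2)).mul (hgc T 4 le_rfl)).add
        ((continuous_const.mul hn).mul (hgc T 3 (by norm_num)))).add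
        (continuous_const.mul (hgc T 2 (by norm_num))))
    · filter_upwards [eventually_ge_atTop 1] with T hT
      refine .of_forall fun y => ?_
      have hs := sq_nonneg ‖y‖
      have hq : 0 < √(1 + ‖y‖ ^ 2) := by positivity
      have hb := abs_bilaplacianProfile_mul_le hs (hgb T hT _ hs)
      rw [← le_div_iff₀ (by positivity)] at hb
      have hwb : |w y| ≤ C * (2 * √(1 + ‖y‖ ^ 2)) :=
        (hC y).trans (mul_le_mul_of_nonneg_left (one_add_le_two_mul_sqrt _) hC0)
      rw [Real.norm_eq_abs, abs_mul]
      refine (mul_le_mul hwb hb (abs_nonneg _) (by positivity)).trans_eq ?_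
      field_simp
    · exact integrable_inv_one_add_norm_sq_sq.const_mul _
    · refine .of_forall fun y => tendsto_const_nhds.congr' ?_
      filter_upwards [hev y 2, hev y 3, hev y 4] with T e2 e3 e4
      simp [bilaplacianProfile, e2, e3, e4]
  have hr : Tendsto (fun T => ∫ y : R3, g T 0 (‖y‖ ^ 2) * (Δ (Δ w)) y) atTop
      (𝓝 (∫ y : R3, d 0 (‖y‖ ^ 2) * (Δ (Δ w)) y)) := by
    refine tendsto_integral_filter_of_dominated_convergence
      (fun y => K * (3 ^ 4 * M) * ‖(Δ (Δ w)) y‖) ?_ ?_ ?_ ?_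
    · exact .of_forall fun T => (hgφ T).continuous.aestronglyMeasurable.mul hi.1
    · filter_upwards [eventually_ge_atTop 1] with T hT
      refine .of_forall fun y => ?_
      rw [norm_mul]
      refine mul_le_mul_of_nonneg_right ?_ (norm_nonneg _)
      have hb := hgb T hT _ (sq_nonneg ‖y‖) 0 (by norm_num)
      simp only [pow_zero, mul_one, one_mul] at hb
      refine hb.trans (mul_le_mul_of_nonneg_right (mul_le_of_le_one_right hK0 ?_) (by positivity))
      refine inv_le_one_of_one_le₀ (Real.one_le_sqrt.2 ?_)
      nlinarith [sq_nonneg ‖y‖]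
    · exact hi.norm.const_mul _
    · refine .of_forall fun y => tendsto_const_nhds.congr' ?_
      filter_upwards [hev y 0] with T e0
      rw [e0]
  refine tendsto_nhds_unique (hl.congr' ?_) hr
  filter_upwards [eventually_ge_atTop 1] with T hT using hid T hT

/-! ### The regularised distance and its bilaplacian -/

/-- The derivatives of `s ↦ (s + a) ^ (1 / 2) - (s + b) ^ (1 / 2)`. -/
noncomputable def sqrtDiffDeriv (a b : ℝ) (k : ℕ) (s : ℝ) : ℝ :=
  (∏ j ∈ Finset.range k, (1 / 2 - (j : ℝ))) *
    ((s + a) ^ (1 / 2 - (k : ℝ)) - (s + b) ^ (1 / 2 - (k : ℝ)))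

theorem hasDerivAt_sqrtDiffDeriv {a b s : ℝ} (ha : 0 < a) (hb : 0 < b) (hs : 0 ≤ s) (k : ℕ) :
    HasDerivAt (sqrtDiffDeriv a b k) (sqrtDiffDeriv a b (k + 1) s) s := by
  have h (a : ℝ) (ha : 0 < a) := ((hasDerivAt_id s).add_const a).rpow_const
    (p := 1 / 2 - (k : ℝ)) (Or.inl (by simp; positivity))
  refine (((h a ha).sub (h b hb)).const_mul (∏ j ∈ Finset.range k, (1 / 2 - (j : ℝ)))).congr_deriv ?_
  rw [sqrtDiffDeriv, Finset.prod_range_succ]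
  push_cast
  simp only [id, one_mul, sub_sub]
  ring

theorem abs_rpow_sub_rpow_le {p s a b m : ℝ} (hp : p ≤ 1) (hs : 0 ≤ s) (hm : 0 < m) (ha : m ≤ a)
    (hb : m ≤ b) : |(s + a) ^ p - (s + b) ^ p| ≤ |p| * (s + m) ^ (p - 1) * |a - b| := by
  have hd (t : ℝ) (ht : t ∈ Set.Ici m) :
      HasDerivWithinAt (fun t => (s + t) ^ p) (p * (s + t) ^ (p - 1)) (Set.Ici m) t := by
    have h : HasDerivAt (fun t => (s + t) ^ p) (1 * p * (s + t) ^ (p - 1)) t :=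
      ((hasDerivAt_id t).const_add s).rpow_const
        (Or.inl (by have := Set.mem_Ici.1 ht; simp only [id]; linarith))
    rw [one_mul] at h
    exact h.hasDerivWithinAt
  refine Convex.norm_image_sub_le_of_norm_hasDerivWithin_le hd (fun t ht => ?_) (convex_Ici m) hb ha
  have ht' := Set.mem_Ici.1 ht
  have ht0 : 0 < t := by linarith
  rw [Real.norm_eq_abs, abs_mul, abs_of_pos (a := (s + t) ^ (p - 1)) (by positivity)]
  exact mul_le_mul_of_nonneg_left
    (Real.rpow_le_rpow_of_nonpos (by positivity) (by linarith) (by linarith)) (abs_nonneg _)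

/-- A single square root grows; by the mean value theorem the difference of two gains a factor `(1 +
s)⁻¹`. This is why two regularisation radii are used together. -/
theorem exists_sqrtDiffDeriv_bound {a b : ℝ} (ha : 0 < a) (hb : 0 < b) (n : ℕ) :
    ∃ K, ∀ k ≤ n, ∀ s, 0 ≤ s → |sqrtDiffDeriv a b k s| * (1 + s) ^ k ≤ K * (√(1 + s))⁻¹ := by
  -- The cap at `1` gives `m(1 + s) ≤ s + m`.
  set m := min 1 (min a b)
  have hm : 0 < m := lt_min one_pos (lt_min ha hb)
  have hk (k : ℕ) : ∃ K, 0 ≤ K ∧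
      ∀ s, 0 ≤ s → |sqrtDiffDeriv a b k s| * (1 + s) ^ k ≤ K * (√(1 + s))⁻¹ := by
    set p : ℝ := 1 / 2 - k with hp
    have hk0 : (0 : ℝ) ≤ k := Nat.cast_nonneg k
    refine ⟨|∏ j ∈ Finset.range k, (1 / 2 - (j : ℝ))| * (|p| * m ^ (p - 1) * |a - b|),
      by positivity, fun s hs => ?_⟩
    have h1 := abs_rpow_sub_rpow_le (p := p) (by linarith) hs hm
      ((min_le_right _ _).trans (min_le_left a b)) ((min_le_right _ _).trans (min_le_right a b))
    have h2 : (s + m) ^ (p - 1) ≤ m ^ (p - 1) * (1 + s) ^ (p - 1) := by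
      rw [← Real.mul_rpow hm.le (by positivity)]
      refine Real.rpow_le_rpow_of_nonpos (by positivity) ?_ (by linarith)
      have : m ≤ 1 := min_le_left _ _
      nlinarith
    have h3 : (1 + s) ^ (p - 1) * (1 + s) ^ k = (√(1 + s))⁻¹ := by
      rw [← Real.rpow_natCast, ← Real.rpow_add (by positivity), Real.sqrt_eq_rpow,
        ← Real.rpow_neg (by positivity), hp]
      congr 1
      ring
    rw [sqrtDiffDeriv, abs_mul, ← h3]
    calc _ ≤ |∏ j ∈ Finset.range k, (1 / 2 - (j : ℝ))| *
          (|p| * (m ^ (p - 1) * (1 + s) ^ (p - 1)) * |a - b|) * (1 + s) ^ k := by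
          gcongr
          refine h1.trans ?_
          gcongr
      _ = _ := by ring
  choose K hK0 hK using hk
  refine ⟨∑ k ∈ Finset.range (n + 1), K k, fun k hkn s hs => (hK k s hs).trans ?_⟩
  refine mul_le_mul_of_nonneg_right ?_ (by positivity)
  exact Finset.single_le_sum (fun k _ => hK0 k) (Finset.mem_range.2 (by omega))

/-- Minus the bilaplacian of `y ↦ √(|y|² + t²)` in three-space. -/
noncomputable def bilaplacianKernel (t : ℝ) (y : R3) : ℝ :=
  15 * t ^ 4 * (√(‖y‖ ^ 2 + t ^ 2) ^ 7)⁻¹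

/-- With `A = s + a`, the three terms of the profile of `√A` form a perfect square: `-15(A - s)²
A^(-7/2) = -15a² A^(-7/2)`. -/
theorem bilaplacianProfile_sqrtDiffDeriv {t r : ℝ} (ht : 0 < t) (hr : 0 < r) (y : R3) :
    bilaplacianProfile (sqrtDiffDeriv (r ^ 2) (t ^ 2)) (‖y‖ ^ 2) =
      bilaplacianKernel t y - bilaplacianKernel r y := by
  have key (s a : ℝ) (hs : 0 ≤ s) (ha : 0 < a) (k : ℕ) :
      (s + a) ^ (1 / 2 - (k : ℝ)) = √(s + a) * ((s + a) ^ k)⁻¹ := by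
    rw [Real.rpow_sub (by positivity), Real.rpow_natCast, ← Real.sqrt_eq_rpow, div_eq_mul_inv]
  have fin (s a : ℝ) (hs : 0 ≤ s) (ha : 0 < a) :
      16 * s ^ 2 * (-(15 / 16) * (√(s + a) * ((s + a) ^ 4)⁻¹)) +
      80 * s * (3 / 8 * (√(s + a) * ((s + a) ^ 3)⁻¹)) +
      60 * (-(1 / 4) * (√(s + a) * ((s + a) ^ 2)⁻¹)) = -(15 * a ^ 2 * (√(s + a) ^ 7)⁻¹) := by
    have hq : 0 < √(s + a) := by positivity
    have hA : s + a = √(s + a) ^ 2 := (Real.sq_sqrt (by positivity)).symm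
    have ha' : a = √(s + a) ^ 2 - s := by linarith
    generalize √(s + a) = q at *
    rw [hA, ha']
    field_simp
    ring
  have h1 := fin (‖y‖ ^ 2) (r ^ 2) (by positivity) (by positivity)
  have h2 := fin (‖y‖ ^ 2) (t ^ 2) (by positivity) (by positivity)
  simp only [bilaplacianProfile, sqrtDiffDeriv, key _ _ (sq_nonneg ‖y‖) (pow_pos hr 2),
    key _ _ (sq_nonneg ‖y‖) (pow_pos ht 2), bilaplacianKernel, Finset.prod_range_succ,
    Finset.prod_range_zero]
  norm_num
  norm_num at h1 h2
  linear_combination h1 - h2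

theorem integral_mul_bilaplacianKernel_sub {w : R3 → ℝ} {C : ℝ} (hw : ContDiff ℝ 4 w)
    (hC : ∀ y, |w y| ≤ C * (1 + ‖y‖)) (hi : Integrable (Δ (Δ w))) {t r : ℝ} (ht : 0 < t)
    (hr : 0 < r) :
    ∫ y : R3, w y * (bilaplacianKernel t y - bilaplacianKernel r y) =
      ∫ y : R3, (√(‖y‖ ^ 2 + r ^ 2) - √(‖y‖ ^ 2 + t ^ 2)) * (Δ (Δ w)) y := by
  obtain ⟨K, hK⟩ := exists_sqrtDiffDeriv_bound (pow_pos hr 2) (pow_pos ht 2) 4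
  have h0 (s : ℝ) : sqrtDiffDeriv (r ^ 2) (t ^ 2) 0 s = √(s + r ^ 2) - √(s + t ^ 2) := by
    simp [sqrtDiffDeriv, Real.sqrt_eq_rpow]
  have hφ : ContDiff ℝ 4 fun y : R3 => sqrtDiffDeriv (r ^ 2) (t ^ 2) 0 (‖y‖ ^ 2) := by
    simp_rw [h0]
    have h (t : ℝ) (ht : 0 < t) : ContDiff ℝ 4 fun y : R3 => √(‖y‖ ^ 2 + t ^ 2) :=
      ((contDiff_norm_sq ℝ).add contDiff_const).sqrt fun y => by positivity
    exact (h r hr).sub (h t ht)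
  have := integral_mul_bilaplacianProfile hw hφ
    (fun k s hs => hasDerivAt_sqrtDiffDeriv (pow_pos hr 2) (pow_pos ht 2) hs k) hK hC hi
  simpa only [bilaplacianProfile_sqrtDiffDeriv ht hr, h0] using this

/-! ### The kernel as an approximate identity -/

theorem bilaplacianKernel_smul {t : ℝ} (ht : 0 < t) (z : R3) :
    bilaplacianKernel t (t • z) = (t ^ 3)⁻¹ * bilaplacianKernel 1 z := by
  have : ‖t • z‖ ^ 2 + t ^ 2 = t ^ 2 * (‖z‖ ^ 2 + 1 ^ 2) := by
    rw [norm_smul, Real.norm_eq_abs, mul_pow, sq_abs]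
    ring
  rw [bilaplacianKernel, bilaplacianKernel, this, Real.sqrt_mul (by positivity),
    Real.sqrt_sq ht.le]
  have : 0 < √(‖z‖ ^ 2 + 1 ^ 2) := by positivity
  field_simp

theorem integral_mul_bilaplacianKernel {t : ℝ} (ht : 0 < t) (F : R3 → ℝ) :
    ∫ y, F y * bilaplacianKernel t y = ∫ z, F (t • z) * bilaplacianKernel 1 z := by
  have h := Measure.integral_comp_smul (volume : Measure R3)
    (fun y => F y * bilaplacianKernel t y) t
  simp only [bilaplacianKernel_smul ht, finrank_euclideanSpace, Fintype.card_fin] at h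
  rw [abs_of_pos (by positivity), eq_inv_smul_iff₀ (by positivity), smul_eq_mul,
    ← integral_const_mul] at h
  rw [← h]
  refine integral_congr_ae (.of_forall fun z => ?_)
  field_simp

theorem integrable_mul_bilaplacianKernel_iff {t : ℝ} (ht : 0 < t) (F : R3 → ℝ) :
    Integrable (fun y => F y * bilaplacianKernel t y) ↔
      Integrable fun z => F (t • z) * bilaplacianKernel 1 z := by
  have e : (fun z => F (t • z) * bilaplacianKernel t (t • z)) =
      fun z => (t ^ 3)⁻¹ * (F (t • z) * bilaplacianKernel 1 z) := by
    ext z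
    rw [bilaplacianKernel_smul ht]
    ring
  rw [← integrable_comp_smul_iff volume _ ht.ne', e,
    integrable_const_mul_iff (Ne.isUnit (by positivity))]

theorem bilaplacianKernel_one_pos (z : R3) : 0 < bilaplacianKernel 1 z := by
  unfold bilaplacianKernel
  positivity

theorem continuous_bilaplacianKernel_one : Continuous (bilaplacianKernel 1) := by
  unfold bilaplacianKernel
  refine continuous_const.mul (Continuous.inv₀ (by fun_prop) fun z => ?_)
  positivity

theorem integrable_one_add_norm_mul_bilaplacianKernel :
    Integrable fun z => (1 + ‖z‖) * bilaplacianKernel 1 z := by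
  refine (integrable_inv_one_add_norm_sq_sq.const_mul 30).mono'
    (((continuous_const.add continuous_norm).mul
      continuous_bilaplacianKernel_one).aestronglyMeasurable) (.of_forall fun z => ?_)
  have hp := bilaplacianKernel_one_pos z
  rw [Real.norm_eq_abs, abs_of_pos (by positivity)]
  have h1 := one_add_le_two_mul_sqrt ‖z‖
  have hA : 1 + ‖z‖ ^ 2 = √(1 + ‖z‖ ^ 2) ^ 2 := (Real.sq_sqrt (by positivity)).symm
  have hq : 1 ≤ √(1 + ‖z‖ ^ 2) := Real.one_le_sqrt.2 (by nlinarith [sq_nonneg ‖z‖])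
  rw [bilaplacianKernel, one_pow, one_pow, add_comm (‖z‖ ^ 2) 1]
  calc _ ≤ 2 * √(1 + ‖z‖ ^ 2) * (15 * 1 * (√(1 + ‖z‖ ^ 2) ^ 7)⁻¹) := by gcongr
    _ ≤ 30 * ((√(1 + ‖z‖ ^ 2) ^ 2) ^ 2)⁻¹ := by
      generalize √(1 + ‖z‖ ^ 2) = q at *
      have hq0 : 0 < q := by linarith
      rw [mul_one, ← pow_mul]
      field_simp
      have := pow_le_pow_right₀ hq (show 2 * 2 ≤ 6 by norm_num)
      linarith
    _ = _ := by rw [← hA]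

theorem integrable_mul_bilaplacianKernel_one {F : R3 → ℝ} {C : ℝ} (hF : Continuous F)
    (hC : ∀ y, |F y| ≤ C * (1 + ‖y‖)) : Integrable fun z => F z * bilaplacianKernel 1 z := by
  refine (integrable_one_add_norm_mul_bilaplacianKernel.const_mul C).mono'
    (hF.mul continuous_bilaplacianKernel_one).aestronglyMeasurable (.of_forall fun z => ?_)
  rw [norm_mul, Real.norm_eq_abs, Real.norm_eq_abs, abs_of_pos (bilaplacianKernel_one_pos z),
    ← mul_assoc]
  exact mul_le_mul_of_nonneg_right (hC z) (bilaplacianKernel_one_pos z).le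

theorem integrable_bilaplacianKernel_one : Integrable (bilaplacianKernel 1) := by
  simpa using integrable_mul_bilaplacianKernel_one (F := fun _ => 1) (C := 1) continuous_const
    (fun y => by simp)

theorem integral_bilaplacianKernel_one_pos : 0 < ∫ z, bilaplacianKernel 1 z := by
  rw [integral_pos_iff_support_of_nonneg (fun z => (bilaplacianKernel_one_pos z).le)
    integrable_bilaplacianKernel_one]
  have : Function.support (bilaplacianKernel 1) = Set.univ :=
    Set.eq_univ_of_forall fun z => (bilaplacianKernel_one_pos z).ne'
  rw [this]
  exact NeZero.pos _

/-- With `P`, `R` the two roots, `(P - R)(P + R) = (p - r)(p + r)` and `|p + r| ≤ P + R`. -/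
theorem abs_sqrt_sq_add_sub_le (p r : ℝ) {a : ℝ} (ha : 0 ≤ a) :
    |√(p ^ 2 + a) - √(r ^ 2 + a)| ≤ |p - r| := by
  have hP : √(p ^ 2 + a) ^ 2 = p ^ 2 + a := Real.sq_sqrt (by positivity)
  have hR : √(r ^ 2 + a) ^ 2 = r ^ 2 + a := Real.sq_sqrt (by positivity)
  have hp : |p| ≤ √(p ^ 2 + a) := Real.abs_le_sqrt (by linarith)
  have hr : |r| ≤ √(r ^ 2 + a) := Real.abs_le_sqrt (by linarith)
  set P := √(p ^ 2 + a)
  set R := √(r ^ 2 + a)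
  have h0 : 0 ≤ P + R := add_nonneg (Real.sqrt_nonneg _) (Real.sqrt_nonneg _)
  rcases h0.eq_or_lt with h | h
  · have hP0 : P = 0 := le_antisymm (by linarith [Real.sqrt_nonneg (r ^ 2 + a)]) (Real.sqrt_nonneg _)
    have hR0 : R = 0 := by linarith
    simp [hP0, hR0]
  · refine le_of_mul_le_mul_right ?_ h
    have e : |P - R| * (P + R) = |p - r| * |p + r| := by
      rw [show |P - R| * (P + R) = |P - R| * |P + R| by rw [abs_of_pos h], ← abs_mul, ← abs_mul]
      congr 1
      linear_combination hP - hR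
    rw [e]
    exact mul_le_mul_of_nonneg_left ((abs_add_le _ _).trans (add_le_add hp hr)) (abs_nonneg _)

/-- Both roots are at least `1` and differ by at most `|h| ≤ 1/2`, so each is at most twice the
other. The constant is `7·2⁶` from the difference of seventh powers times `2⁷` from comparing
denominators. -/
theorem abs_bilaplacianKernel_sub_le {z h : R3} (hh : ‖h‖ ≤ 1 / 2) :
    |bilaplacianKernel 1 (z - h) - bilaplacianKernel 1 z| ≤
      7 * 2 ^ 13 * ‖h‖ * bilaplacianKernel 1 z := by
  have hd : |√(‖z - h‖ ^ 2 + 1 ^ 2) - √(‖z‖ ^ 2 + 1 ^ 2)| ≤ ‖h‖ := by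
    refine (abs_sqrt_sq_add_sub_le _ _ (by positivity)).trans ((abs_norm_sub_norm_le _ _).trans ?_)
    simp
  have hr : 1 ≤ √(‖z‖ ^ 2 + 1 ^ 2) := Real.one_le_sqrt.2 (by nlinarith [sq_nonneg ‖z‖])
  have hp : 1 ≤ √(‖z - h‖ ^ 2 + 1 ^ 2) := Real.one_le_sqrt.2 (by nlinarith [sq_nonneg ‖z - h‖])
  unfold bilaplacianKernel
  generalize √(‖z - h‖ ^ 2 + 1 ^ 2) = p at *
  generalize √(‖z‖ ^ 2 + 1 ^ 2) = r at *
  have hd' := abs_le.1 (hd.trans hh)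
  have hp0 : 0 < p := by linarith
  have hr0 : 0 < r := by linarith
  have h1 : |r ^ 7 - p ^ 7| ≤ ‖h‖ * 7 * (2 * r) ^ 6 := by
    refine (abs_pow_sub_pow_le r p 7).trans ?_
    rw [abs_of_pos hp0, abs_of_pos hr0, abs_sub_comm]
    push_cast
    gcongr
    exact max_le (by linarith) (by linarith)
  have h2 : r ^ 7 ≤ 2 ^ 7 * p ^ 7 := by
    rw [← mul_pow]
    exact pow_le_pow_left₀ hr0.le (by linarith) 7
  have h3 : r ^ 6 ≤ r ^ 7 := pow_le_pow_right₀ hr (by norm_num)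
  have e : 15 * 1 ^ 4 * (p ^ 7)⁻¹ - 15 * 1 ^ 4 * (r ^ 7)⁻¹ =
      15 * ((r ^ 7 - p ^ 7) * (p ^ 7 * r ^ 7)⁻¹) := by
    field_simp
  rw [e, abs_mul, abs_mul, abs_of_pos (a := (p ^ 7 * r ^ 7)⁻¹) (by positivity),
    abs_of_pos (a := (15 : ℝ)) (by norm_num)]
  calc _ ≤ 15 * (‖h‖ * 7 * (2 * r) ^ 6 * (p ^ 7 * r ^ 7)⁻¹) := by gcongr
    _ = 15 * 7 * 2 ^ 6 * ‖h‖ * (r ^ 6 * (p ^ 7)⁻¹) * (r ^ 7)⁻¹ := by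
      rw [mul_inv, mul_pow]
      ring
    _ ≤ 15 * 7 * 2 ^ 6 * ‖h‖ * 2 ^ 7 * (r ^ 7)⁻¹ := by
      gcongr
      rw [mul_inv_le_iff₀ (by positivity)]
      linarith
    _ = _ := by ring

/-! ### The potential representation of sublinear functions -/

/-- The kernel identity centred at `x` with radii `t` and `t⁻¹`, rescaled. As `t → ∞` the small
scale recovers `w x`, while the large scale sees only growth at infinity. -/
theorem integral_comp_smul_mul_bilaplacianKernel_sub {w : R3 → ℝ} {C : ℝ} (hw : ContDiff ℝ 4 w)
    (hC : ∀ y, |w y| ≤ C * (1 + ‖y‖)) (hi : Integrable (Δ (Δ w))) {t : ℝ} (ht : 0 < t)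
    (x : R3) :
    (∫ z, w (x + t • z) * bilaplacianKernel 1 z) - ∫ z, w (x + t⁻¹ • z) * bilaplacianKernel 1 z =
      ∫ y : R3, (√(‖y - x‖ ^ 2 + t⁻¹ ^ 2) - √(‖y - x‖ ^ 2 + t ^ 2)) * (Δ (Δ w)) y := by
  have hC0 : 0 ≤ C := by
    have := hC 0
    simp only [norm_zero, add_zero, mul_one] at this
    exact (abs_nonneg _).trans this
  have hwx : ContDiff ℝ 4 fun y => w (y + x) := hw.comp (contDiff_id.add contDiff_const)
  have hlin (t : ℝ) (y : R3) : |w (t • y + x)| ≤ C * (1 + ‖x‖ + |t|) * (1 + ‖y‖) := by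
    refine (hC _).trans ?_
    rw [mul_assoc]
    refine mul_le_mul_of_nonneg_left ?_ hC0
    have : ‖t • y + x‖ ≤ |t| * ‖y‖ + ‖x‖ := by
      simpa [norm_smul] using norm_add_le (t • y) x
    nlinarith [norm_nonneg x, norm_nonneg y, abs_nonneg t,
      mul_nonneg (norm_nonneg x) (norm_nonneg y)]
  have hint (t : ℝ) (ht : 0 < t) :
      Integrable fun y => w (y + x) * bilaplacianKernel t y := by
    rw [integrable_mul_bilaplacianKernel_iff ht fun y => w (y + x)]
    exact integrable_mul_bilaplacianKernel_one
      (hw.continuous.comp (by fun_prop : Continuous fun z : R3 => t • z + x)) (hlin t)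
  have hΔ : Δ (Δ fun y => w (y + x)) = fun y => (Δ (Δ w)) (y + x) := by
    rw [laplacian_comp_add_const, laplacian_comp_add_const]
  have h := integral_mul_bilaplacianKernel_sub hwx (C := C * (1 + ‖x‖ + |1|))
    (fun y => by simpa using hlin 1 y) (by rw [hΔ]; exact hi.comp_add_right x) ht (inv_pos.2 ht)
  simp_rw [mul_sub] at h
  rw [integral_sub (hint t ht) (hint _ (inv_pos.2 ht)),
    integral_mul_bilaplacianKernel ht fun y => w (y + x),
    integral_mul_bilaplacianKernel (inv_pos.2 ht) fun y => w (y + x), hΔ] at h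
  simp_rw [add_comm x]
  rw [h]
  simpa [-inv_pow] using integral_add_right_eq_self (μ := volume) (fun y : R3 =>
    (√(‖y - x‖ ^ 2 + t⁻¹ ^ 2) - √(‖y - x‖ ^ 2 + t ^ 2)) * (Δ (Δ w)) y) x

theorem tendsto_integral_comp_smul_mul_bilaplacianKernel {w : R3 → ℝ} {C : ℝ}
    (hw : Continuous w) (hC : ∀ y, |w y| ≤ C * (1 + ‖y‖)) (x : R3) :
    Tendsto (fun t : ℝ => ∫ z, w (x + t⁻¹ • z) * bilaplacianKernel 1 z) atTop
      (𝓝 (w x * ∫ z, bilaplacianKernel 1 z)) := by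
  have hC0 : 0 ≤ C := by
    have := hC 0
    simp only [norm_zero, add_zero, mul_one] at this
    exact (abs_nonneg _).trans this
  rw [← integral_const_mul]
  refine tendsto_integral_filter_of_dominated_convergence
    (fun z => C * (1 + ‖x‖) * ((1 + ‖z‖) * bilaplacianKernel 1 z)) ?_ ?_ ?_ ?_
  · refine .of_forall fun t => Continuous.aestronglyMeasurable ?_
    exact (hw.comp (by fun_prop : Continuous fun z : R3 => x + t⁻¹ • z)).mul
      continuous_bilaplacianKernel_one
  · filter_upwards [eventually_ge_atTop 1] with t ht
    refine .of_forall fun z => ?_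
    rw [norm_mul, Real.norm_eq_abs, Real.norm_eq_abs, abs_of_pos (bilaplacianKernel_one_pos z),
      ← mul_assoc]
    refine mul_le_mul_of_nonneg_right ((hC _).trans ?_) (bilaplacianKernel_one_pos z).le
    rw [mul_assoc]
    refine mul_le_mul_of_nonneg_left ?_ hC0
    have h1 : ‖x + t⁻¹ • z‖ ≤ ‖x‖ + ‖z‖ := by
      refine (norm_add_le _ _).trans (add_le_add le_rfl ?_)
      rw [norm_smul, Real.norm_eq_abs, abs_of_pos (by positivity)]
      exact mul_le_of_le_one_left (norm_nonneg _) (inv_le_one_of_one_le₀ ht)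
    nlinarith [mul_nonneg (norm_nonneg x) (norm_nonneg z)]
  · exact integrable_one_add_norm_mul_bilaplacianKernel.const_mul _
  · refine .of_forall fun z => Tendsto.mul_const _ ?_
    have h : Tendsto (fun t : ℝ => x + t⁻¹ • z) atTop (𝓝 x) := by
      simpa using tendsto_const_nhds.add ((tendsto_inv_atTop_zero (𝕜 := ℝ)).smul_const z)
    exact (hw.tendsto x).comp h

theorem exists_abs_le_of_isLittleO_norm {w : R3 → ℝ} (hw : Continuous w)
    (ho : w =o[Bornology.cobounded R3] fun y => ‖y‖) :
    ∃ C, ∀ y, |w y| ≤ C * (1 + ‖y‖) := by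
  have h1 := ho.bound one_pos
  rw [Metric.cobounded_eq_cocompact] at h1
  obtain ⟨K, hK, hKs⟩ := mem_cocompact.1 h1
  obtain ⟨M, hM⟩ := hK.exists_bound_of_continuousOn hw.continuousOn
  refine ⟨|M| + 1, fun y => ?_⟩
  have hy := norm_nonneg y
  have hM0 := abs_nonneg M
  by_cases h : y ∈ K
  · have := (hM y h).trans (le_abs_self M)
    rw [Real.norm_eq_abs] at this
    nlinarith [mul_nonneg hM0 hy]
  · have : ‖w y‖ ≤ 1 * ‖‖y‖‖ := hKs h
    rw [Real.norm_eq_abs, norm_norm] at this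
    nlinarith [mul_nonneg hM0 hy]

theorem tendsto_comp_smul_div {w : R3 → ℝ} (ho : w =o[Bornology.cobounded R3] fun y => ‖y‖)
    (z : R3) : Tendsto (fun t : ℝ => w (t • z) / t) atTop (𝓝 0) := by
  rcases eq_or_ne z 0 with rfl | hz
  · simpa using tendsto_const_nhds.div_atTop (a := w 0) tendsto_id
  have ht : Tendsto (fun t : ℝ => t • z) atTop (Bornology.cobounded R3) := by
    rw [← tendsto_norm_atTop_iff_cobounded]
    simp_rw [norm_smul]
    exact (tendsto_norm_atTop_atTop).atTop_mul_const (norm_pos_iff.2 hz)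
  have h := (ho.comp_tendsto ht).tendsto_div_nhds_zero
  have h' := h.mul_const ‖z‖
  rw [zero_mul] at h'
  refine h'.congr' ?_
  filter_upwards [eventually_gt_atTop 0] with t ht
  have := norm_pos_iff.2 hz
  simp only [Function.comp_apply, norm_smul, Real.norm_eq_abs, abs_of_pos ht]
  field_simp

/-- Moving the shift onto the kernel turns it into a shift by `x/t`, which costs `O(|x|/t)` relative
to the kernel. The remaining factor `w(tz)/t` tends to `0` by sublinearity. -/
theorem tendsto_integral_comp_smul_mul_bilaplacianKernel_sub {w : R3 → ℝ} {C : ℝ}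
    (hw : Continuous w) (hC : ∀ y, |w y| ≤ C * (1 + ‖y‖))
    (ho : w =o[Bornology.cobounded R3] fun y => ‖y‖) (x : R3) :
    Tendsto (fun t : ℝ => (∫ z, w (x + t • z) * bilaplacianKernel 1 z) -
      ∫ z, w (t • z) * bilaplacianKernel 1 z) atTop (𝓝 0) := by
  have hC0 : 0 ≤ C := by
    have := hC 0
    simp only [norm_zero, add_zero, mul_one] at this
    exact (abs_nonneg _).trans this
  have hlin (x : R3) (t : ℝ) (y : R3) : |w (x + t • y)| ≤ C * (1 + ‖x‖ + |t|) * (1 + ‖y‖) := by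
    refine (hC _).trans ?_
    rw [mul_assoc]
    refine mul_le_mul_of_nonneg_left ?_ hC0
    have : ‖x + t • y‖ ≤ ‖x‖ + |t| * ‖y‖ := by
      simpa [norm_smul] using norm_add_le x (t • y)
    nlinarith [norm_nonneg x, norm_nonneg y, abs_nonneg t,
      mul_nonneg (norm_nonneg x) (norm_nonneg y)]
  have hint (x : R3) (t : ℝ) : Integrable fun z => w (x + t • z) * bilaplacianKernel 1 z :=
    integrable_mul_bilaplacianKernel_one (hw.comp (by fun_prop)) (hlin x t)
  have hshift (t : ℝ) (ht : 0 < t) :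
      (fun z => w (x + t • z) * bilaplacianKernel 1 z) =
        fun z => (fun z => w (t • z) * bilaplacianKernel 1 (z - t⁻¹ • x)) (z + t⁻¹ • x) := by
    ext z
    simp [smul_add, smul_smul, ht.ne', add_comm]
  have heq : ∀ᶠ t : ℝ in atTop, ∫ z, (w (t • z) / t) *
      (t * (bilaplacianKernel 1 (z - t⁻¹ • x) - bilaplacianKernel 1 z)) =
      (∫ z, w (x + t • z) * bilaplacianKernel 1 z) - ∫ z, w (t • z) * bilaplacianKernel 1 z := by
    filter_upwards [eventually_gt_atTop 0] with t ht
    have h1 : Integrable fun z => w (t • z) * bilaplacianKernel 1 (z - t⁻¹ • x) := by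
      have h := hint x t
      rw [hshift t ht] at h
      have := h.comp_add_right (-(t⁻¹ • x))
      simpa using this
    have h2 : Integrable fun z => w (t • z) * bilaplacianKernel 1 z := by simpa using hint 0 t
    rw [hshift t ht, integral_add_right_eq_self (μ := volume)
      (fun z => w (t • z) * bilaplacianKernel 1 (z - t⁻¹ • x)), ← integral_sub h1 h2]
    refine integral_congr_ae (.of_forall fun z => ?_)
    field_simp
  refine Tendsto.congr' heq ?_
  rw [← integral_zero R3 ℝ (μ := volume)]
  have hb : ∀ᶠ t : ℝ in atTop, ∀ z,
      |t * (bilaplacianKernel 1 (z - t⁻¹ • x) - bilaplacianKernel 1 z)| ≤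
        7 * 2 ^ 13 * ‖x‖ * bilaplacianKernel 1 z := by
    filter_upwards [eventually_ge_atTop (2 * ‖x‖), eventually_ge_atTop 1] with t htx ht z
    have ht0 : 0 < t := by linarith
    have hn : ‖t⁻¹ • x‖ = ‖x‖ / t := by
      rw [norm_smul, Real.norm_eq_abs, abs_of_pos (by positivity)]
      ring
    have h := abs_bilaplacianKernel_sub_le (z := z) (h := t⁻¹ • x)
      (by rw [hn, div_le_iff₀ ht0]; linarith)
    rw [abs_mul, abs_of_pos ht0]
    refine (mul_le_mul_of_nonneg_left h ht0.le).trans_eq ?_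
    rw [hn]
    field_simp
  refine tendsto_integral_filter_of_dominated_convergence
    (fun z => C * (7 * 2 ^ 13 * ‖x‖) * ((1 + ‖z‖) * bilaplacianKernel 1 z)) ?_ ?_ ?_ ?_
  · refine .of_forall fun t => Continuous.aestronglyMeasurable ?_
    exact ((hw.comp (by fun_prop)).div_const t).mul (continuous_const.mul
      ((continuous_bilaplacianKernel_one.comp (by fun_prop)).sub continuous_bilaplacianKernel_one))
  · filter_upwards [hb, eventually_ge_atTop 1] with t hb ht
    refine .of_forall fun z => ?_
    have ht0 : 0 < t := by linarith
    have h1 : |w (t • z) / t| ≤ C * (1 + ‖z‖) := by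
      rw [abs_div, abs_of_pos ht0, div_le_iff₀ ht0, mul_assoc]
      refine (hC _).trans (mul_le_mul_of_nonneg_left ?_ hC0)
      rw [norm_smul, Real.norm_eq_abs, abs_of_pos ht0]
      linarith
    rw [Real.norm_eq_abs, abs_mul]
    refine (mul_le_mul h1 (hb z) (abs_nonneg _) (by positivity)).trans_eq (by ring)
  · exact integrable_one_add_norm_mul_bilaplacianKernel.const_mul _
  · refine .of_forall fun z => ?_
    refine Tendsto.zero_mul_isBoundedUnder_le (tendsto_comp_smul_div ho z) ?_
    exact isBoundedUnder_of_eventually_le (hb.mono fun t ht => ht z)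

theorem tendsto_sqrt_sq_add_sq_sub (p : ℝ) :
    Tendsto (fun t : ℝ => √(p ^ 2 + t ^ 2) - t) atTop (𝓝 0) := by
  refine squeeze_zero' (g := fun t => p ^ 2 / t) ?_ ?_ (tendsto_const_nhds.div_atTop tendsto_id)
  · filter_upwards [eventually_gt_atTop 0] with t ht
    rw [sub_nonneg]
    exact Real.le_sqrt_of_sq_le (by nlinarith [sq_nonneg p])
  · filter_upwards [eventually_gt_atTop 0] with t ht
    have h1 : √(p ^ 2 + t ^ 2) ^ 2 = p ^ 2 + t ^ 2 := Real.sq_sqrt (by positivity)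
    have h2 : t ≤ √(p ^ 2 + t ^ 2) := Real.le_sqrt_of_sq_le (by nlinarith [sq_nonneg p])
    rw [le_div_iff₀ ht]
    nlinarith

theorem tendsto_sqrt_sq_add_inv_sq {p : ℝ} (hp : 0 ≤ p) :
    Tendsto (fun t : ℝ => √(p ^ 2 + t⁻¹ ^ 2)) atTop (𝓝 p) := by
  have h : Tendsto (fun t : ℝ => p ^ 2 + t⁻¹ ^ 2) atTop (𝓝 (p ^ 2)) := by
    simpa using tendsto_const_nhds.add ((tendsto_inv_atTop_zero (𝕜 := ℝ)).pow 2)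
  simpa [Real.sqrt_sq hp] using h.sqrt

/-- A `C⁴` function of sublinear growth with integrable bilaplacian is the potential of its
bilaplacian, up to a constant. -/
theorem integral_mul_bilaplacian_of_isLittleO {w : R3 → ℝ} (hw : ContDiff ℝ 4 w)
    (ho : w =o[Bornology.cobounded R3] fun y => ‖y‖) (hi : Integrable (Δ (Δ w))) (x : R3) :
    (∫ z, bilaplacianKernel 1 z) * (w x - w 0) =
      -∫ y : R3, (‖y - x‖ - ‖y‖) * (Δ (Δ w)) y := by
  obtain ⟨C, hC⟩ := exists_abs_le_of_isLittleO_norm hw.continuous ho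
  have hsq (x : R3) (r : ℝ) : Continuous fun y : R3 => √(‖y - x‖ ^ 2 + r ^ 2) := by fun_prop
  have hlip (x y : R3) (r : ℝ) :
      |√(‖y - x‖ ^ 2 + r ^ 2) - √(‖y‖ ^ 2 + r ^ 2)| ≤ ‖x‖ := by
    refine (abs_sqrt_sq_add_sub_le _ _ (sq_nonneg r)).trans
      ((abs_norm_sub_norm_le _ _).trans_eq ?_)
    simp
  have hint (x : R3) (t : ℝ) (ht : 0 < t) :
      Integrable fun y => (√(‖y - x‖ ^ 2 + t⁻¹ ^ 2) - √(‖y - x‖ ^ 2 + t ^ 2)) * (Δ (Δ w)) y := by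
    refine hi.bdd_mul (c := t + t⁻¹) ((hsq x _).sub (hsq x _)).aestronglyMeasurable
      (.of_forall fun y => ?_)
    have h1 (r : ℝ) (hr : 0 < r) : ‖y - x‖ ≤ √(‖y - x‖ ^ 2 + r ^ 2) ∧
        √(‖y - x‖ ^ 2 + r ^ 2) ≤ ‖y - x‖ + r :=
      ⟨Real.le_sqrt_of_sq_le (by nlinarith), by
        rw [Real.sqrt_le_left (by positivity)]
        nlinarith [mul_nonneg (norm_nonneg (y - x)) hr.le]⟩
    have ha := h1 t ht
    have hb := h1 t⁻¹ (inv_pos.2 ht)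
    have := inv_pos.2 ht
    rw [Real.norm_eq_abs, abs_le]
    constructor <;> linarith
  -- The identities at `x` and at `0` are subtracted: separately, their right sides need not
  -- converge as `t → ∞`.
  have hl := (tendsto_integral_comp_smul_mul_bilaplacianKernel_sub hw.continuous hC ho x).sub
    ((tendsto_integral_comp_smul_mul_bilaplacianKernel hw.continuous hC x).sub
      (tendsto_integral_comp_smul_mul_bilaplacianKernel hw.continuous hC 0))
  have hr : Tendsto (fun t : ℝ => ∫ y : R3,
      ((√(‖y - x‖ ^ 2 + t⁻¹ ^ 2) - √(‖y‖ ^ 2 + t⁻¹ ^ 2)) -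
        (√(‖y - x‖ ^ 2 + t ^ 2) - √(‖y‖ ^ 2 + t ^ 2))) * (Δ (Δ w)) y) atTop
      (𝓝 (∫ y : R3, (‖y - x‖ - ‖y‖) * (Δ (Δ w)) y)) := by
    refine tendsto_integral_filter_of_dominated_convergence
      (fun y => (‖x‖ + ‖x‖) * ‖(Δ (Δ w)) y‖) ?_ ?_ ?_ ?_
    · refine .of_forall fun t => AEStronglyMeasurable.mul ?_ hi.1
      have h1 := hsq x t
      have h2 := hsq x t⁻¹
      have h3 := hsq 0 t
      have h4 := hsq 0 t⁻¹
      simp only [sub_zero] at h3 h4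
      exact ((h2.sub h4).sub (h1.sub h3)).aestronglyMeasurable
    · refine .of_forall fun t => .of_forall fun y => ?_
      rw [norm_mul]
      refine mul_le_mul_of_nonneg_right ?_ (norm_nonneg _)
      exact (abs_sub _ _).trans (add_le_add (hlip x y _) (hlip x y _))
    · exact hi.norm.const_mul _
    -- The large-scale bracket vanishes in the limit because both roots are `t + o(1)`.
    · refine .of_forall fun y => Tendsto.mul_const _ ?_
      have h := ((tendsto_sqrt_sq_add_inv_sq (norm_nonneg (y - x))).sub
        (tendsto_sqrt_sq_add_inv_sq (norm_nonneg y))).sub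
        ((tendsto_sqrt_sq_add_sq_sub ‖y - x‖).sub (tendsto_sqrt_sq_add_sq_sub ‖y‖))
      simpa using h
  have heq := tendsto_nhds_unique (hl.congr' ?_) hr
  · linear_combination -heq
  filter_upwards [eventually_gt_atTop 0] with t ht
  have hx := integral_comp_smul_mul_bilaplacianKernel_sub hw hC hi ht x
  have h0 := integral_comp_smul_mul_bilaplacianKernel_sub hw hC hi ht 0
  have e : ∫ y : R3,
      ((√(‖y - x‖ ^ 2 + t⁻¹ ^ 2) - √(‖y‖ ^ 2 + t⁻¹ ^ 2)) -
        (√(‖y - x‖ ^ 2 + t ^ 2) - √(‖y‖ ^ 2 + t ^ 2))) * (Δ (Δ w)) y =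
      (∫ y : R3, (√(‖y - x‖ ^ 2 + t⁻¹ ^ 2) - √(‖y - x‖ ^ 2 + t ^ 2)) * (Δ (Δ w)) y) -
      ∫ y : R3, (√(‖y - 0‖ ^ 2 + t⁻¹ ^ 2) - √(‖y - 0‖ ^ 2 + t ^ 2)) * (Δ (Δ w)) y := by
    rw [← integral_sub (hint x t ht) (hint 0 t ht)]
    refine integral_congr_ae (.of_forall fun y => ?_)
    simp only [sub_zero]
    ring
  rw [e, ← hx, ← h0]
  simp only [zero_add]
  ring

/-! ### Linear growth and integrability of the nonlinearity -/

theorem GrowthCondition.isLittleO {u : R3 → ℝ} {L ϑ : ℝ} (h : GrowthCondition u L ϑ)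
    (hϑ : 0 < ϑ) : (fun x => u x - L * ‖x‖) =o[Bornology.cobounded R3] fun x => ‖x‖ := by
  have h0 : (fun x : R3 => ‖x‖⁻¹ * u x - L) =o[Bornology.cobounded R3] fun _ => (1 : ℝ) := by
    refine IsLittleO.trans h ((isLittleO_one_iff ℝ).2 ?_)
    exact (tendsto_rpow_neg_atTop hϑ).comp tendsto_norm_cobounded_atTop
  have h1 := h0.mul_isBigO (isBigO_refl (fun x : R3 => ‖x‖) (Bornology.cobounded R3))
  refine h1.congr' ?_ (.of_forall fun x => one_mul _)
  filter_upwards [tendsto_norm_cobounded_atTop.eventually_gt_atTop 0] with x hx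
  field_simp

theorem exists_mul_one_add_norm_le {u : R3 → ℝ} {L : ℝ} (hu : Continuous u) (hpos : ∀ x, 0 < u x)
    (hL : 0 < L) (h : (fun x => u x - L * ‖x‖) =o[Bornology.cobounded R3] fun x => ‖x‖) :
    ∃ m, 0 < m ∧ ∀ x, m * (1 + ‖x‖) ≤ u x := by
  have h1 := (h.bound (half_pos hL)).and (tendsto_norm_cobounded_atTop.eventually_ge_atTop 1)
  rw [Metric.cobounded_eq_cocompact] at h1
  obtain ⟨K, hK, hKs⟩ := mem_cocompact.1 h1
  have hcont : Continuous fun x : R3 => u x / (1 + ‖x‖) :=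
    hu.div (by fun_prop) fun x => by positivity
  obtain ⟨m, hm, hmK⟩ := hK.exists_forall_le' hcont.continuousOn
    (a := 0) fun x _ => div_pos (hpos x) (by positivity)
  -- Off the compact set `|x| ≥ 1` and `u x ≥ L|x|/2`, hence `u x ≥ (L/4)(1 + |x|)`.
  refine ⟨min m (L / 4), lt_min hm (by positivity), fun x => ?_⟩
  by_cases hx : x ∈ K
  · have := hmK x hx
    rw [le_div_iff₀ (by positivity)] at this
    exact (mul_le_mul_of_nonneg_right (min_le_left _ _) (by positivity)).trans this
  · obtain ⟨h2, h3⟩ := hKs hx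
    rw [Real.norm_eq_abs, norm_norm] at h2
    have h4 := (abs_le.1 h2).1
    refine (mul_le_mul_of_nonneg_right (min_le_right _ _) (by positivity)).trans ?_
    nlinarith

theorem integrable_rpow_of_le {u : R3 → ℝ} {q m : ℝ} (hq : 3 < q) (hu : Continuous u)
    (hm : 0 < m) (hmu : ∀ x, m * (1 + ‖x‖) ≤ u x) : Integrable fun x => u x ^ (-q) := by
  have hp (x : R3) : 0 < u x := lt_of_lt_of_le (by positivity) (hmu x)
  have hj : Integrable fun x : R3 => (1 + ‖x‖) ^ (-q) :=
    integrable_one_add_norm (by simpa using hq)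
  refine (hj.const_mul (m ^ (-q))).mono'
    (hu.rpow_const fun x => Or.inl (hp x).ne').aestronglyMeasurable (.of_forall fun x => ?_)
  have h0 := hp x
  rw [Real.norm_eq_abs, abs_of_pos (by positivity), ← Real.mul_rpow hm.le (by positivity)]
  exact Real.rpow_le_rpow_of_nonpos (by positivity) (hmu x) (by linarith)

/-! ### Reflection and the improved kernel -/

/-- The integrand is odd under the measure-preserving involution `T`. -/
theorem integral_mul_sub_comp_eq_zero {h f : R3 → ℝ} (T : R3 ≃ₗᵢ[ℝ] R3) (hT : ∀ y, T (T y) = y)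
    (hh : ∀ y, h (T y) = h y) : ∫ y, h y * (f y - f (T y)) = 0 := by
  have e := T.measurePreserving.integral_comp' (f := T.toMeasurableEquiv)
    (fun y => h y * (f y - f (T y)))
  have e' : ∫ y, h (T y) * (f (T y) - f (T (T y))) = ∫ y, h y * (f y - f (T y)) := e
  simp_rw [hT, hh] at e'
  have : ∫ y, h y * (f (T y) - f y) = -∫ y, h y * (f y - f (T y)) := by
    rw [← integral_neg]
    refine integral_congr_ae (.of_forall fun y => ?_)
    ring
  linarith

/-- The difference of the values of an entire solution at a point and at its mirror image. -/
theorem IsPositiveEntireSolution.sub_comp_eq_integral {q : ℝ} {u : R3 → ℝ}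
    (hu : IsPositiveEntireSolution q u) {L : ℝ}
    (ho : (fun x => u x - L * ‖x‖) =o[Bornology.cobounded R3] fun x => ‖x‖)
    (hi : Integrable fun x => u x ^ (-q)) (T : R3 ≃ₗᵢ[ℝ] R3) (hT : ∀ y, T (T y) = y) (x : R3) :
    (∫ z, bilaplacianKernel 1 z) * (u x - u (T x)) =
      ∫ y, (‖y - x‖ - max ‖x‖ ‖y‖) * (u y ^ (-q) - u (T y) ^ (-q)) := by
  have huT : ContDiff ℝ 4 fun y => u (T y) := hu.contDiff.comp T.contDiff
  have hc : Tendsto T (Bornology.cobounded R3) (Bornology.cobounded R3) := by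
    rw [← tendsto_norm_atTop_iff_cobounded]
    simpa using tendsto_norm_cobounded_atTop (E := R3)
  have how : (fun y => u y - u (T y)) =o[Bornology.cobounded R3] fun y => ‖y‖ := by
    have h1 := ho.comp_tendsto hc
    simp only [Function.comp_def, LinearIsometryEquiv.norm_map] at h1
    refine (ho.sub h1).congr_left fun y => by ring
  have hΔ : Δ (Δ fun y => u y - u (T y)) = fun y => -(u y ^ (-q) - u (T y) ^ (-q)) := by
    have e1 : (Δ fun y => u y - u (T y)) = (Δ u) - fun y => (Δ u) (T y) := by
      ext y
      have := ContDiffAt.laplacian_sub (hu.contDiff.of_le (by norm_num)).contDiffAt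
        (huT.of_le (by norm_num)).contDiffAt (x := y)
      rw [laplacian_comp_linearIsometryEquiv] at this
      exact this
    have hΔu : ContDiff ℝ 2 (Δ u) := contDiff_laplacian (m := 2) hu.contDiff
    have hΔuT : ContDiff ℝ 2 fun y => (Δ u) (T y) := hΔu.comp T.contDiff
    rw [e1]
    ext y
    rw [ContDiffAt.laplacian_sub hΔu.contDiffAt hΔuT.contDiffAt,
      laplacian_comp_linearIsometryEquiv, hu.eqn]
    simp only [hu.eqn]
    ring
  have hiT : Integrable fun y => u (T y) ^ (-q) :=
    (T.measurePreserving.integrable_comp_emb T.toMeasurableEquiv.measurableEmbedding).2 hi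
  have hd : Integrable fun y => u y ^ (-q) - u (T y) ^ (-q) := hi.sub hiT
  have hbd {h : R3 → ℝ} (hc : Continuous h) (hb : ∀ y, |h y| ≤ ‖x‖) :
      Integrable fun y => h y * (u y ^ (-q) - u (T y) ^ (-q)) :=
    hd.bdd_mul (c := ‖x‖) hc.aestronglyMeasurable (.of_forall hb)
  have hrep := integral_mul_bilaplacian_of_isLittleO (hu.contDiff.sub huT) how
    (by rw [hΔ]; exact hd.neg) x
  rw [hΔ, map_zero, sub_self, sub_zero] at hrep
  -- This radial weight integrates to zero, so `|y|` in the kernel can be replaced by `max ‖x‖ ‖y‖`.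
  -- The new kernel is bounded by `|y|` as well as by `|x|`.
  have hz := integral_mul_sub_comp_eq_zero (h := fun y => max ‖x‖ ‖y‖ - ‖y‖)
    (f := fun y => u y ^ (-q)) T hT fun y => by simp
  have i1 := hbd (h := fun y => ‖y - x‖ - ‖y‖) (by fun_prop) fun y => by
    simpa using abs_norm_sub_norm_le (y - x) y
  have i2 := hbd (h := fun y => max ‖x‖ ‖y‖ - ‖y‖) (by fun_prop) fun y => by
    rw [abs_of_nonneg (sub_nonneg.2 (le_max_right _ _)), sub_le_iff_le_add]
    exact max_le (by linarith [norm_nonneg y]) (by linarith [norm_nonneg x])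
  rw [hrep, ← sub_zero (-_), ← hz]
  simp only [mul_neg, integral_neg, neg_neg]
  rw [← integral_sub i1 i2]
  refine integral_congr_ae (.of_forall fun y => ?_)
  ring

/-! ### Bootstrapping the oscillation bound -/

/-- The oscillation of `u` over the sphere of radius `r` is `O((1 + r) ^ α)`. -/
def OscillationBound (u : R3 → ℝ) (α : ℝ) : Prop :=
  ∃ A, ∀ x x' : R3, ‖x‖ = ‖x'‖ → |u x - u x'| ≤ A * (1 + ‖x‖) ^ α

theorem abs_norm_sub_sub_max_le (x y : R3) : |‖y - x‖ - max ‖x‖ ‖y‖| ≤ min ‖x‖ ‖y‖ := by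
  have h1 := norm_sub_le y x
  have h2 := abs_le.1 (abs_norm_sub_norm_le y x)
  rw [abs_le]
  rcases le_total ‖x‖ ‖y‖ with h | h
  · rw [max_eq_right h, min_eq_left h]
    constructor <;> linarith
  · rw [max_eq_left h, min_eq_right h]
    constructor <;> linarith

/-- Interpolation that splits the kernel bound between growth in `x` and decay available in `y`. -/
theorem min_le_rpow_mul_rpow {a b β : ℝ} (ha : 0 ≤ a) (hb : 0 ≤ b) (h0 : 0 ≤ β) (h1 : β ≤ 1) :
    min a b ≤ (1 + a) ^ β * (1 + b) ^ (1 - β) := by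
  have hm : 0 < 1 + min a b := by positivity
  calc min a b ≤ 1 + min a b := by linarith
    _ = (1 + min a b) ^ β * (1 + min a b) ^ (1 - β) := by
      rw [← Real.rpow_add hm, add_sub_cancel, Real.rpow_one]
    _ ≤ (1 + a) ^ β * (1 + b) ^ (1 - β) := by
      gcongr
      · exact min_le_left _ _
      · exact min_le_right _ _

/-- The mean value theorem for `t ↦ t^(-q)` on `t ≥ m(1 + |y|)` bounds the source by `(1 + |y|)^(α -
q - 1)`. Against `(1 + |x|)^β (1 + |y|)^(1 - β)` the integrand has exponent `-(q + β - α)`, below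
`-3` exactly when `α - β < q - 3`. -/
theorem IsPositiveEntireSolution.oscillationBound_improve {q : ℝ} {u : R3 → ℝ}
    (hu : IsPositiveEntireSolution q u) (hq : 3 < q) {L : ℝ} (hL : 0 < L)
    (ho : (fun x => u x - L * ‖x‖) =o[Bornology.cobounded R3] fun x => ‖x‖)
    {α β : ℝ} (hα : OscillationBound u α) (hβ₀ : 0 ≤ β) (hβ₁ : β ≤ 1) (h : α - β < q - 3) :
    OscillationBound u β := by
  obtain ⟨m, hm, hmu⟩ := exists_mul_one_add_norm_le hu.contDiff.continuous hu.pos hL ho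
  obtain ⟨A, hA⟩ := hα
  have hA0 : 0 ≤ A := by
    have := hA 0 0 rfl
    simpa using this
  have hΛ := integral_bilaplacianKernel_one_pos
  set Λ := ∫ z, bilaplacianKernel 1 z with hΛdef
  have hi := integrable_rpow_of_le hq hu.contDiff.continuous hm hmu
  set B := q * m ^ (-q - 1) * A
  have hJ : Integrable fun y : R3 => (1 + ‖y‖) ^ (-(q + β - α)) :=
    integrable_one_add_norm (by simp; linarith)
  refine ⟨Λ⁻¹ * (B * ∫ y : R3, (1 + ‖y‖) ^ (-(q + β - α))), fun x x' hxx' => ?_⟩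
  have hB0 : 0 ≤ B := by positivity
  -- Reflection in the plane orthogonal to `x - x'`, which swaps the two points as their norms
  -- agree.
  let T : R3 ≃ₗᵢ[ℝ] R3 := (ℝ ∙ (x - x'))ᗮ.reflection
  have hTx : T x = x' := Submodule.reflection_sub hxx'
  have hrep := hu.sub_comp_eq_integral ho hi T (Submodule.reflection_reflection _) x
  rw [hTx, ← hΛdef] at hrep
  have hf (y : R3) : |u y ^ (-q) - u (T y) ^ (-q)| ≤ B * (1 + ‖y‖) ^ (α - q - 1) := by
    have hn : ‖T y‖ = ‖y‖ := T.norm_map y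
    have h1 := abs_rpow_sub_rpow_le (p := -q) (s := 0) (a := u y) (b := u (T y))
      (m := m * (1 + ‖y‖)) (by linarith) le_rfl (by positivity) (hmu y)
      (by rw [← hn]; exact hmu (T y))
    simp only [zero_add, abs_neg, abs_of_pos (show 0 < q by linarith)] at h1
    refine h1.trans ?_
    rw [Real.mul_rpow hm.le (by positivity), sub_sub α q 1, sub_eq_add_neg α,
      Real.rpow_add (by positivity), neg_add']
    calc _ ≤ q * (m ^ (-q - 1) * (1 + ‖y‖) ^ (-q - 1)) * (A * (1 + ‖y‖) ^ α) := by
          gcongr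
          exact hA y (T y) hn.symm
      _ = _ := by ring
  have hbound : |Λ * (u x - u x')| ≤
      ∫ y : R3, (1 + ‖x‖) ^ β * B * (1 + ‖y‖) ^ (-(q + β - α)) := by
    rw [hrep, ← Real.norm_eq_abs]
    refine norm_integral_le_of_norm_le (hJ.const_mul ((1 + ‖x‖) ^ β * B))
      (.of_forall fun y => ?_)
    rw [norm_mul]
    calc _ ≤ (1 + ‖x‖) ^ β * (1 + ‖y‖) ^ (1 - β) * (B * (1 + ‖y‖) ^ (α - q - 1)) := by
          refine mul_le_mul ?_ (hf y) (norm_nonneg _) (by positivity)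
          exact (abs_norm_sub_sub_max_le x y).trans
            (min_le_rpow_mul_rpow (norm_nonneg _) (norm_nonneg _) hβ₀ hβ₁)
      _ = (1 + ‖x‖) ^ β * B * ((1 + ‖y‖) ^ (1 - β) * (1 + ‖y‖) ^ (α - q - 1)) := by ring
      _ = _ := by
          rw [← Real.rpow_add (by positivity)]
          congr 2
          ring
  rw [integral_const_mul, abs_mul, abs_of_pos hΛ] at hbound
  rw [mul_assoc Λ⁻¹, inv_mul_eq_div, le_div_iff₀' hΛ]
  refine hbound.trans_eq ?_
  ring

theorem IsPositiveEntireSolution.oscillationBound_zero {q : ℝ} {u : R3 → ℝ}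
    (hu : IsPositiveEntireSolution q u) (hq : 3 < q) {L : ℝ} (hL : 0 < L)
    (ho : (fun x => u x - L * ‖x‖) =o[Bornology.cobounded R3] fun x => ‖x‖) :
    OscillationBound u 0 := by
  -- Half the admissible gain, since the improvement needs a strict inequality.
  set δ := (q - 3) / 2 with hδ
  have hδ0 : 0 < δ := by linarith
  have key (n : ℕ) : OscillationBound u (max 0 (1 - n * δ)) := by
    induction n with
    | zero =>
      -- Exponent `1` to start: `L‖x‖` is constant on spheres and the remainder grows at most
      -- linearly.
      obtain ⟨C, hC⟩ := exists_abs_le_of_isLittleO_norm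
        (hu.contDiff.continuous.sub (by fun_prop)) ho
      refine ⟨2 * C, fun x x' hxx' => ?_⟩
      have h1 : |u x - L * ‖x‖| ≤ C * (1 + ‖x‖) := hC x
      have h2 : |u x' - L * ‖x'‖| ≤ C * (1 + ‖x'‖) := hC x'
      rw [← hxx'] at h2
      simp only [CharP.cast_eq_zero, zero_mul, sub_zero, zero_le_one, sup_of_le_right,
        Real.rpow_one]
      rw [show u x - u x' = (u x - L * ‖x‖) - (u x' - L * ‖x‖) by ring]
      exact (abs_sub _ _).trans (by linarith)
    | succ n ih =>
      refine hu.oscillationBound_improve hq hL ho ih (le_max_left _ _) (max_le zero_le_one ?_) ?_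
      · have : (0 : ℝ) ≤ ((n + 1 : ℕ) : ℝ) * δ := by positivity
        linarith
      · rw [sub_lt_iff_lt_add]
        push_cast
        refine max_lt ?_ ?_
        · have := le_max_left 0 (1 - ((n : ℝ) + 1) * δ)
          linarith
        · have := le_max_right 0 (1 - ((n : ℝ) + 1) * δ)
          linarith
  obtain ⟨n, hn⟩ := exists_nat_ge (1 / δ)
  have := key n
  rwa [max_eq_left] at this
  rw [div_le_iff₀ hδ0] at hn
  linarith

/-! ### Back to the Kelvin transform -/

theorem kelvin_smul {u : R3 → ℝ} {L s : ℝ} (hs : 0 < s) (θ : S2) :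
    kelvin u L (s • (θ : R3)) = s * u (s⁻¹ • (θ : R3)) - L := by
  have hθ : ‖(θ : R3)‖ = 1 := by simp
  have hn : ‖s • (θ : R3)‖ = s := by rw [norm_smul, hθ, mul_one, Real.norm_of_nonneg hs.le]
  have hinv : inversion (s • (θ : R3)) = s⁻¹ • (θ : R3) := by
    rw [inversion, hn, smul_smul]
    congr 1
    field_simp
  rw [kelvin, hinv, norm_smul, hθ, mul_one, Real.norm_of_nonneg (by positivity), inv_inv]

instance : IsFiniteMeasure surfaceMeasure := by
  unfold surfaceMeasure
  infer_instance

theorem surfaceMeasure_real_univ_pos : 0 < surfaceMeasure.real Set.univ :=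
  have : NeZero surfaceMeasure := ⟨Measure.toSphere_ne_zero _⟩
  measureReal_univ_pos

/-- The non-radial part at `θ` is the mean over `θ'` of `v(sθ) - v(sθ')`, so the oscillation bounds
it pointwise. -/
theorem nonRadialNorm_le {v : R3 → ℝ} {s K : ℝ}
    (hv : Continuous fun θ : S2 => v (s • (θ : R3)))
    (hK : ∀ θ θ' : S2, |v (s • (θ : R3)) - v (s • (θ' : R3))| ≤ K) :
    nonRadialNorm v s ≤ √(surfaceMeasure.real Set.univ) * K := by
  have hM := surfaceMeasure_real_univ_pos
  have hi : Integrable (fun θ : S2 => v (s • (θ : R3))) surfaceMeasure :=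
    hv.integrable_of_hasCompactSupport (HasCompactSupport.of_compactSpace _)
  have hpt (θ : S2) : |nonRadialPart v s θ| ≤ K := by
    have e : nonRadialPart v s θ = (surfaceMeasure.real Set.univ)⁻¹ *
        ∫ θ' : S2, (v (s • (θ : R3)) - v (s • (θ' : R3))) ∂surfaceMeasure := by
      rw [integral_sub (integrable_const _) hi, integral_const, nonRadialPart, sphericalAverage,
        smul_eq_mul]
      field_simp
    have h := norm_integral_le_of_norm_le_const (μ := surfaceMeasure) (C := K)
      (f := fun θ' => v (s • (θ : R3)) - v (s • (θ' : R3)))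
      (.of_forall fun θ' => hK θ θ')
    rw [e, abs_mul, abs_of_pos (inv_pos.2 hM), inv_mul_le_iff₀ hM, mul_comm]
    exact h
  obtain ⟨θ⟩ : Nonempty S2 := by
    by_contra hne
    rw [not_nonempty_iff] at hne
    simp [Measure.eq_zero_of_isEmpty] at hM
  have hK0 : 0 ≤ K := (abs_nonneg _).trans (hpt θ)
  have h := norm_integral_le_of_norm_le_const (μ := surfaceMeasure) (C := K ^ 2)
    (f := fun θ => nonRadialPart v s θ ^ 2) (.of_forall fun θ => by
      rw [norm_pow]
      exact pow_le_pow_left₀ (abs_nonneg _) (hpt θ) 2)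
  refine (Real.sqrt_le_sqrt ((le_abs_self _).trans h)).trans_eq ?_
  rw [mul_comm, Real.sqrt_mul hM.le, Real.sqrt_sq hK0]

theorem proposition3p1 (q : ℝ) (hq : 3 < q) (u : R3 → ℝ) (hu : IsPositiveEntireSolution q u)
    (L ϑ : ℝ) (hL : 0 < L) (hϑ₀ : 0 < ϑ) (hϑ₁ : ϑ < 1) (hgrowth : GrowthCondition u L ϑ) :
    ∃ C : ℝ, 0 < C ∧ ∃ s₀ : ℝ, 0 < s₀ ∧
      ∀ s : ℝ, 0 < s → s < s₀ → nonRadialNorm (kelvin u L) s ≤ C * s := by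
  obtain ⟨A, hA⟩ := hu.oscillationBound_zero hq hL (hgrowth.isLittleO hϑ₀)
  have hA0 : 0 ≤ A := by simpa using hA 0 0 rfl
  -- The added `1` keeps the constant positive when `A = 0`; the estimate holds for every `s > 0`,
  -- so `s₀ = 1` is arbitrary.
  refine ⟨√(surfaceMeasure.real Set.univ) * A + 1, by positivity, 1, one_pos, fun s hs _ => ?_⟩
  refine (nonRadialNorm_le (K := s * A) ?_ fun θ θ' => ?_).trans ?_
  · simp_rw [kelvin_smul hs]
    have := hu.contDiff.continuous
    fun_prop
  · have h := hA (s⁻¹ • (θ : R3)) (s⁻¹ • (θ' : R3)) (by simp [norm_smul])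
    rw [Real.rpow_zero, mul_one] at h
    rw [kelvin_smul hs, kelvin_smul hs, sub_sub_sub_cancel_right, ← mul_sub, abs_mul,
      abs_of_pos hs]
    exact mul_le_mul_of_nonneg_left h hs.le
  · rw [add_mul, mul_left_comm, mul_comm s]
    linarith
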